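/- Let $\delta,\ell,b,P>0$. Put $\mathcal C_0=[0,\ell]$ and $\mathcal C_{n}=\tfrac13\,\mathcal C_{n-1}\cup\tfrac13(\mathcal C_{n-1}+2\ell)$ for $n\ge1$, and let $\mathcal C=\bigcap_n\mathcal C_n$ be the middle-third Cantor set on $[0,\ell]$. Let $\mathcal W$ be the set of all $u\in W^{2,2}(-\delta,\ell)$ with $u=0$ on $(-\delta,0]$, and for $u\in\mathcal W$ let $$E_n(u)=\tfrac12\int_0^\ell b_n|u''|^2\,d\mathcal L-P\,u(\ell),\qquad b_n=\begin{cases}(2/3)^n\,b&\text{on }\mathcal C_n,\\ +\infty&\text{off }\mathcal C_n,\end{cases}$$ where $\mathcal L$ is Lebesgue measure, $\infty\cdot 0=0$, and $u(\ell)$ is the value at $\ell$ of the continuous representative of $u$ (and $E_n(u)=+\infty$ for $u\notin\mathcal W$). Let $(u_n)$ be a sequence in $\mathcal W$ with $\sup_n E_n(u_n)<\infty$. Then there are a subsequence, still denoted $(u_n)$, and a function $u\in W^{1,1}(-\delta,\ell)$ with $u'\in BV(-\delta,\ell)$, so that the distributional derivative $u''$ of $u'$ is a finite real Radon measure on $(-\delta,\ell)$,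 such that 1. $u_n\to u$ in $W^{1,1}(-\delta,\ell)$; 2. $u_n''\mathcal L\stackrel{*}{\rightharpoonup}u''$ as measures on $(-\delta,\ell)$, that is, $\int_{-\delta}^{\ell}\psi\,u_n''\,d\mathcal L\to\int_{(-\delta,\ell)}\psi\,du''$ for every $\psi\in C_c(-\delta,\ell)$; 3. $u''$ is absolutely continuous with respect to $\eta=\dfrac{\ell}{\mathcal H^s(\mathcal C)}\,\mathcal H^s\llcorner\mathcal C$, where $s=\ln 2/\ln 3$ and $\mathcal H^s$ is the $s$-dimensional Hausdorff measure. -/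

import Mathlib

open MeasureTheory Set Filter Topology
open scoped ENNReal ContDiff CompactlySupported

namespace CantorBeam

noncomputable section

/-! ### Weak derivatives, Sobolev spaces and functions of bounded variation on `Ω ⊆ ℝ`

Elements of function spaces on `Ω` are represented by functions `ℝ → ℝ`; only their values at almost
every point of `Ω` matter. -/

/-- Smooth test functions with compact support contained in `Ω`. -/
def IsTestFunction (Ω : Set ℝ) (φ : ℝ → ℝ) : Prop :=
  ContDiff ℝ ∞ φ ∧ HasCompactSupport φ ∧ tsupport φ ⊆ Ω

/-- `g` is a weak derivative of `f` on `Ω`. -/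
def IsWeakDeriv (Ω : Set ℝ) (f g : ℝ → ℝ) : Prop :=
  LocallyIntegrableOn f Ω ∧ LocallyIntegrableOn g Ω ∧
    ∀ φ : ℝ → ℝ, IsTestFunction Ω φ →
      ∫ x in Ω, f x * deriv φ x = -∫ x in Ω, g x * φ x

open Classical in
/-- The weak derivative of `f` on `Ω` (unique up to null sets when `Ω` is open); it is `0` by
convention if `f` has no weak derivative. -/
def weakDeriv (Ω : Set ℝ) (f : ℝ → ℝ) : ℝ → ℝ :=
  if h : ∃ g, IsWeakDeriv Ω f g then h.choose else 0

/-- `MemSobolev Ω m p u`: the function `u` belongs to `W^{m,p}(Ω)`. -/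
def MemSobolev (Ω : Set ℝ) : ℕ → ℝ≥0∞ → (ℝ → ℝ) → Prop
  | 0, p, u => MemLp u p (volume.restrict Ω)
  | m + 1, p, u =>
      MemLp u p (volume.restrict Ω) ∧ ∃ g, IsWeakDeriv Ω u g ∧ MemSobolev Ω m p g

/-- The norm `∑_{k ≤ m} ‖f^{(k)}‖_{L^p(Ω)}` of `W^{m,p}(Ω)`. -/
def sobolevNorm (Ω : Set ℝ) (m : ℕ) (p : ℝ≥0∞) (f : ℝ → ℝ) : ℝ≥0∞ :=
  ∑ k ∈ Finset.range (m + 1), eLpNorm ((weakDeriv Ω)^[k] f) p (volume.restrict Ω)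

/-- Strong convergence `u n → v` in `W^{m,p}(Ω)`. -/
def TendstoSobolev (Ω : Set ℝ) (m : ℕ) (p : ℝ≥0∞) (u : ℕ → ℝ → ℝ) (v : ℝ → ℝ) : Prop :=
  (∀ n, MemSobolev Ω m p (u n)) ∧ MemSobolev Ω m p v ∧
    Tendsto (fun n => sobolevNorm Ω m p (fun x => u n x - v x)) atTop (𝓝 0)

/-- The finite real (Radon) measure `μ` on `Ω` is the distributional derivative of `f` on `Ω`. -/
def IsMeasureDeriv (Ω : Set ℝ) (f : ℝ → ℝ) (μ : SignedMeasure Ω) : Prop :=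
  LocallyIntegrableOn f Ω ∧
    ∀ φ : ℝ → ℝ, IsTestFunction Ω φ →
      ∫ x in Ω, f x * deriv φ x = -∫ᵛ x : Ω, φ x ∂<•μ

/-- `f ∈ BV(Ω)`: `f` is in `L¹(Ω)` and its distributional derivative is a finite real measure. -/
def MemBV (Ω : Set ℝ) (f : ℝ → ℝ) : Prop :=
  MemLp f 1 (volume.restrict Ω) ∧ ∃ μ : SignedMeasure Ω, IsMeasureDeriv Ω f μ

/-- The real measure `f 𝓛` on `Ω` with density `f ∈ L¹(Ω)` with respect to Lebesgue measure. -/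
def densityMeasure (Ω : Set ℝ) (f : ℝ → ℝ) : SignedMeasure Ω :=
  ((volume : Measure ℝ).comap ((↑) : Ω → ℝ)).withDensityᵥ (fun x : Ω => f x)

/-- Weak* convergence of real measures on `Ω`, tested against `C_c(Ω)`. -/
def TendstoWeakStar {Ω : Set ℝ} (μ : ℕ → SignedMeasure Ω) (ν : SignedMeasure Ω) : Prop :=
  ∀ ψ : C_c(Ω, ℝ), Tendsto (fun n => ∫ᵛ x, ψ x ∂<•(μ n)) atTop (𝓝 (∫ᵛ x, ψ x ∂<•ν))

open Classical in
/-- The value at the right endpoint `c` of the continuous representative on `[a, c]` of a function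
given almost everywhere on `(a, c)`; it is `0` by convention if there is no such representative. -/
def rightEndpointValue (a c : ℝ) (u : ℝ → ℝ) : ℝ :=
  if h : ∃ v : ℝ → ℝ, ContinuousOn v (Icc a c) ∧ u =ᵐ[volume.restrict (Ioo a c)] v
    then h.choose c else 0

/-! ### The Cantor set and the energies -/

/-- The `n`-th step `C_n` of the construction of the middle third Cantor set on `[0, ℓ]`. -/
def cantorStep (ℓ : ℝ) : ℕ → Set ℝ
  | 0 => Icc 0 ℓ
  | n + 1 => (fun x => x / 3) '' cantorStep ℓ n ∪ (fun x => (x + 2 * ℓ) / 3) '' cantorStep ℓ n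

/-- The middle third Cantor set on `[0, ℓ]`. -/
def beamCantorSet (ℓ : ℝ) : Set ℝ := ⋂ n, cantorStep ℓ n

/-- The dimension `s = ln 2 / ln 3`. -/
def cantorDim : ℝ := Real.log 2 / Real.log 3

/-- The measure `η = (ℓ / H^s(C)) H^s⌞C`. It does not depend on the normalization of `H^s`. -/
def cantorMeasure (ℓ : ℝ) : Measure ℝ :=
  (ENNReal.ofReal ℓ / μH[cantorDim] (beamCantorSet ℓ)) •
    (μH[cantorDim] : Measure ℝ).restrict (beamCantorSet ℓ)

open Classical in
/-- The bending stiffness: `(2/3)^n b` on `C_n` and `∞` off `C_n`. -/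
def stiffness (ℓ b : ℝ) (n : ℕ) (x : ℝ) : ℝ≥0∞ :=
  if x ∈ cantorStep ℓ n then ENNReal.ofReal ((2 / 3) ^ n * b) else ⊤

/-- The space `𝒲` of `u ∈ W^{2,2}(-δ, ℓ)` that vanish on `(-δ, 0]`. -/
def admissible (δ ℓ : ℝ) : Set (ℝ → ℝ) :=
  {u | MemSobolev (Ioo (-δ) ℓ) 2 2 u ∧ ∀ᵐ x ∂volume.restrict (Ioc (-δ) 0), u x = 0}

open Classical in
/-- The energy `E_n(u) = ½ ∫_0^ℓ b_n |u''|² d𝓛 - P u(ℓ)` for `u ∈ 𝒲`, and `+∞` otherwise, with the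
usual convention `∞ · 0 = 0` in the integrand. -/
def energy (δ ℓ b P : ℝ) (n : ℕ) (u : ℝ → ℝ) : EReal :=
  if u ∈ admissible δ ℓ then
    ((2⁻¹ * ∫⁻ x in Ioo 0 ℓ, stiffness ℓ b n x *
        ‖weakDeriv (Ioo (-δ) ℓ) (weakDeriv (Ioo (-δ) ℓ) u) x‖ₑ ^ 2 : ℝ≥0∞) : EReal)
      - ((P * rightEndpointValue (-δ) ℓ u : ℝ) : EReal)
  else ⊤

end

end CantorBeam

open CantorBeam

namespace CantorBeam

/-! ### Weak derivatives on intervals -/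

/-! A bounded energy forces `u_n''` to vanish a.e. off `C_n`. Transport it to a fixed interval: the
map `T_n = cantorParam ℓ n` carries Lebesgue measure on `[0, ℓ)` to `(3/2)^n 𝓛⌞C_n`
(`map_cantorParam`). Hence `k_n = (2/3)^n u_n'' ∘ T_n` satisfies `∫ ψ u_n'' = ∫ ψ(T_n) k_n` for all
bounded Borel `ψ`, and `∫ k_n² = (2/3)^n ∫ |u_n''|²` is exactly what the stiffness controls. The
load is at most a multiple of `∫ |k_n|`, so Young's inequality absorbs it and `(k_n)` is bounded in
`L²` (`exists_bound_scaledCurvature`).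

Pass to a weak limit `k`. Since `T_n → T = cantorMap ℓ`, the functions `ψ(T_n)` converge boundedly
a.e., hence strongly in `L²`, whenever `ψ` is bounded and continuous at `T(y)` for a.e. `y`; the
product of a strongly and a weakly convergent sequence passes to the limit
(`exists_subseq_tendsto_integral_mul`). Continuous `ψ` with compact support give weak* convergence
to `μ = T_#(k 𝓛)`. Indicators of `(-∞, x]` are allowed because `T_#𝓛` has no atoms; they give
pointwise convergence of `u_n'`, then `L¹` convergence by domination, and `u_n` follows by
integration.

For absolute continuity, `T_#𝓛` gives mass at most `ℓ 2⁻ᵏ` to sets of diameter below `ℓ 3⁻ᵏ`. As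
`3^s = 2`, the mass distribution principle bounds it by a multiple of `H^s` (`map_cantorMap_le`).
Finiteness of `H^s(C)` ensures that `η`-null sets are `H^s⌞C`-null. -/

theorem IsTestFunction.continuous {Ω : Set ℝ} {φ : ℝ → ℝ} (h : IsTestFunction Ω φ) :
    Continuous φ := h.1.continuous

theorem IsTestFunction.eq_zero_of_notMem {Ω : Set ℝ} {φ : ℝ → ℝ} (h : IsTestFunction Ω φ) {x : ℝ}
    (hx : x ∉ Ω) : φ x = 0 :=
  image_eq_zero_of_notMem_tsupport fun hx' => hx (h.2.2 hx')

theorem IsTestFunction.mono {Ω Ω' : Set ℝ} (hΩ : Ω ⊆ Ω') {φ : ℝ → ℝ} (h : IsTestFunction Ω φ) :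
    IsTestFunction Ω' φ := ⟨h.1, h.2.1, h.2.2.trans hΩ⟩

theorem IsTestFunction.deriv {Ω : Set ℝ} {φ : ℝ → ℝ} (h : IsTestFunction Ω φ) :
    IsTestFunction Ω (deriv φ) :=
  ⟨(contDiff_infty_iff_deriv.1 h.1).2, h.2.1.deriv, tsupport_deriv_subset.trans h.2.2⟩

theorem IsTestFunction.setIntegral_mul {Ω : Set ℝ} {φ : ℝ → ℝ} (h : IsTestFunction Ω φ)
    (f : ℝ → ℝ) : ∫ x in Ω, f x * φ x = ∫ x, f x * φ x :=
  setIntegral_eq_integral_of_forall_compl_eq_zero fun x hx => by simp [h.eq_zero_of_notMem hx]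

theorem IsTestFunction.integrable_mul {Ω : Set ℝ} {φ f : ℝ → ℝ} (h : IsTestFunction Ω φ)
    (hf : LocallyIntegrableOn f Ω) : Integrable (fun x => f x * φ x) := by
  have h1 : IntegrableOn (fun x => f x * φ x) (tsupport φ) :=
    (hf.integrableOn_compact_subset h.2.2 h.2.1).mul_continuousOn h.continuous.continuousOn h.2.1
  rw [← integrableOn_iff_integrable_of_support_subset (s := tsupport φ)]
  · exact h1
  · exact (Function.support_mul_subset_right _ _).trans (subset_tsupport φ)

theorem ae_eq_of_forall_testFunction {Ω : Set ℝ} (hΩ : IsOpen Ω) {f g : ℝ → ℝ}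
    (hf : LocallyIntegrableOn f Ω) (hg : LocallyIntegrableOn g Ω)
    (h : ∀ φ, IsTestFunction Ω φ → ∫ x in Ω, f x * φ x = ∫ x in Ω, g x * φ x) :
    f =ᵐ[volume.restrict Ω] g := by
  have := hΩ.ae_eq_zero_of_integral_contDiff_smul_eq_zero (hf.sub hg) (fun φ h1 h2 h3 => by
    have hφ : IsTestFunction Ω φ := ⟨h1, h2, h3⟩
    have h4 := h φ hφ
    rw [hφ.setIntegral_mul, hφ.setIntegral_mul] at h4
    rw [← sub_eq_zero, ← integral_sub (hφ.integrable_mul hf) (hφ.integrable_mul hg)] at h4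
    rw [← h4]
    congr 1 with x
    simp [smul_eq_mul]; ring)
  rw [Filter.EventuallyEq, ae_restrict_iff' hΩ.measurableSet]
  filter_upwards [this] with x hx hxΩ
  exact sub_eq_zero.1 (hx hxΩ)

theorem locallyIntegrableOn_congr {Ω : Set ℝ} {f g : ℝ → ℝ}
    (h : f =ᵐ[volume.restrict Ω] g) (hf : LocallyIntegrableOn f Ω) : LocallyIntegrableOn g Ω := by
  intro x hx
  obtain ⟨s, hs, hfs⟩ := hf x hx
  refine ⟨s ∩ Ω, inter_mem hs self_mem_nhdsWithin, ?_⟩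
  refine (hfs.mono_set inter_subset_left).congr_fun_ae ?_
  exact ae_mono (Measure.restrict_mono inter_subset_right le_rfl) h

theorem IsWeakDeriv.ae_eq {Ω : Set ℝ} (hΩ : IsOpen Ω) {f g₁ g₂ : ℝ → ℝ}
    (h₁ : IsWeakDeriv Ω f g₁) (h₂ : IsWeakDeriv Ω f g₂) : g₁ =ᵐ[volume.restrict Ω] g₂ :=
  ae_eq_of_forall_testFunction hΩ h₁.2.1 h₂.2.1 fun φ hφ =>
    neg_injective ((h₁.2.2 φ hφ).symm.trans (h₂.2.2 φ hφ))

theorem IsWeakDeriv.congr {Ω : Set ℝ} {f₁ f₂ g₁ g₂ : ℝ → ℝ}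
    (h : IsWeakDeriv Ω f₁ g₁) (hf : f₁ =ᵐ[volume.restrict Ω] f₂)
    (hg : g₁ =ᵐ[volume.restrict Ω] g₂) : IsWeakDeriv Ω f₂ g₂ := by
  refine ⟨locallyIntegrableOn_congr hf h.1, locallyIntegrableOn_congr hg h.2.1,
    fun φ hφ => ?_⟩
  rw [integral_congr_ae (g := fun x => f₁ x * deriv φ x), h.2.2 φ hφ,
    integral_congr_ae (g := fun x => g₂ x * φ x)]
  · filter_upwards [hg] with x hx
    rw [hx]
  · filter_upwards [hf] with x hx
    rw [hx]

theorem IsWeakDeriv.isWeakDeriv_weakDeriv {Ω : Set ℝ} {f g : ℝ → ℝ} (h : IsWeakDeriv Ω f g) :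
    IsWeakDeriv Ω f (weakDeriv Ω f) := by
  have : ∃ g, IsWeakDeriv Ω f g := ⟨g, h⟩
  rw [weakDeriv, dif_pos this]
  exact this.choose_spec

theorem IsWeakDeriv.weakDeriv_ae_eq {Ω : Set ℝ} (hΩ : IsOpen Ω) {f g : ℝ → ℝ}
    (h : IsWeakDeriv Ω f g) : weakDeriv Ω f =ᵐ[volume.restrict Ω] g :=
  h.isWeakDeriv_weakDeriv.ae_eq hΩ h

theorem IsWeakDeriv.sub {Ω : Set ℝ} {f₁ f₂ g₁ g₂ : ℝ → ℝ} (h₁ : IsWeakDeriv Ω f₁ g₁)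
    (h₂ : IsWeakDeriv Ω f₂ g₂) :
    IsWeakDeriv Ω (fun x => f₁ x - f₂ x) (fun x => g₁ x - g₂ x) := by
  refine ⟨h₁.1.sub h₂.1, h₁.2.1.sub h₂.2.1, fun φ hφ => ?_⟩
  simp_rw [sub_mul]
  rw [integral_sub (hφ.deriv.integrable_mul h₁.1).integrableOn
      (hφ.deriv.integrable_mul h₂.1).integrableOn,
    integral_sub (hφ.integrable_mul h₁.2.1).integrableOn (hφ.integrable_mul h₂.2.1).integrableOn,
    h₁.2.2 φ hφ, h₂.2.2 φ hφ]
  ring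

theorem IsWeakDeriv.mono {Ω Ω' : Set ℝ} (hΩ : Ω ⊆ Ω') {f g : ℝ → ℝ} (h : IsWeakDeriv Ω' f g) :
    IsWeakDeriv Ω f g := by
  refine ⟨h.1.mono_set hΩ, h.2.1.mono_set hΩ, fun φ hφ => ?_⟩
  have := h.2.2 φ (hφ.mono hΩ)
  rwa [(hφ.mono hΩ).setIntegral_mul, (hφ.deriv.mono hΩ).setIntegral_mul, ← hφ.setIntegral_mul,
    ← hφ.deriv.setIntegral_mul] at this

theorem ae_eq_zero_of_isWeakDeriv {Ω : Set ℝ} (hΩ : IsOpen Ω) {f g : ℝ → ℝ}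
    (h : IsWeakDeriv Ω f g) (hf : f =ᵐ[volume.restrict Ω] 0) : g =ᵐ[volume.restrict Ω] 0 := by
  refine h.ae_eq hΩ (IsWeakDeriv.congr (f₁ := 0) (g₁ := 0) ?_ hf.symm .rfl)
  have h0 : LocallyIntegrableOn (0 : ℝ → ℝ) Ω := locallyIntegrableOn_zero
  exact ⟨h0, h0, by simp⟩

/-- Integration by parts for absolutely continuous functions; `φ` vanishes at both endpoints because
they lie outside the open interval. -/
theorem integral_primitive_mul_deriv {a c : ℝ} (hac : a ≤ c) {g φ : ℝ → ℝ}
    (hg : IntegrableOn g (Ioo a c)) (hφ : IsTestFunction (Ioo a c) φ) :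
    ∫ x in Ioo a c, (∫ t in a..x, g t) * deriv φ x = -∫ x in Ioo a c, g x * φ x := by
  have hi : IntervalIntegrable g volume a c :=
    (intervalIntegrable_iff_integrableOn_Ioo_of_le hac).2 hg
  have hG := hi.absolutelyContinuousOnInterval_intervalIntegral (c := a) left_mem_uIcc
  have hφ' : AbsolutelyContinuousOnInterval φ a c :=
    (hφ.1.of_le (by exact_mod_cast le_top)).contDiffOn.absolutelyContinuousOnInterval
  have := hG.integral_mul_deriv_eq_deriv_mul hφ'
  rw [hφ.eq_zero_of_notMem (x := a) (by simp), hφ.eq_zero_of_notMem (x := c) (by simp)] at this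
  simp only [mul_zero, sub_zero, zero_sub] at this
  rw [← integral_Ioc_eq_integral_Ioo, ← integral_Ioc_eq_integral_Ioo,
    ← intervalIntegral.integral_of_le hac, ← intervalIntegral.integral_of_le hac, this]
  congr 1
  refine intervalIntegral.integral_congr_ae ?_
  filter_upwards [hi.ae_hasDerivAt_integral] with x hx hx'
  rw [(hx (uIoc_subset_uIcc hx') a left_mem_uIcc).deriv]

theorem continuousOn_primitive_Ioo {a c : ℝ} (hac : a ≤ c) {g : ℝ → ℝ}
    (hg : IntegrableOn g (Ioo a c)) : ContinuousOn (fun x => ∫ t in a..x, g t) (Icc a c) := by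
  have hi : IntervalIntegrable g volume a c :=
    (intervalIntegrable_iff_integrableOn_Ioo_of_le hac).2 hg
  have := (hi.absolutelyContinuousOnInterval_intervalIntegral (c := a) left_mem_uIcc).continuousOn
  rwa [uIcc_of_le hac] at this

theorem isWeakDeriv_primitive {a c : ℝ} (hac : a ≤ c) {g : ℝ → ℝ} (hg : IntegrableOn g (Ioo a c)) :
    IsWeakDeriv (Ioo a c) (fun x => ∫ t in a..x, g t) g :=
  ⟨((continuousOn_primitive_Ioo hac hg).integrableOn_Icc.mono_set
      Ioo_subset_Icc_self).locallyIntegrableOn, hg.locallyIntegrableOn,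
    fun _ hφ => integral_primitive_mul_deriv hac hg hφ⟩

/-- The primitive started at the left end of the support vanishes to the left of it trivially, and
to the right of it because the mean of `θ` is zero. -/
theorem exists_testFunction_primitive {a c : ℝ} {θ : ℝ → ℝ}
    (hθ : IsTestFunction (Ioo a c) θ) (h0 : ∫ x, θ x = 0) :
    ∃ ψ, IsTestFunction (Ioo a c) ψ ∧ deriv ψ = θ := by
  rcases (tsupport θ).eq_empty_or_nonempty with he | hne
  · refine ⟨0, ⟨contDiff_const, HasCompactSupport.zero, by simp⟩, ?_⟩
    rw [tsupport_eq_empty_iff] at he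
    simp [he]
  have hK : IsCompact (tsupport θ) := hθ.2.1
  obtain ⟨a', ha', ha''⟩ := hK.exists_isLeast hne
  obtain ⟨c', hc', hc''⟩ := hK.exists_isGreatest hne
  have hsub : Icc a' c' ⊆ Ioo a c := fun x hx =>
    ⟨(hθ.2.2 ha').1.trans_le hx.1, hx.2.trans_lt (hθ.2.2 hc').2⟩
  have hz : ∀ x, x ∉ Icc a' c' → θ x = 0 := fun x hx =>
    image_eq_zero_of_notMem_tsupport fun hx' => hx ⟨ha'' hx', hc'' hx'⟩
  have hint : Integrable θ := hθ.continuous.integrable_of_hasCompactSupport hθ.2.1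
  have hd : ∀ x, HasDerivAt (fun x => ∫ t in a'..x, θ t) (θ x) x := fun x =>
    hθ.continuous.integral_hasStrictDerivAt a' x |>.hasDerivAt
  have hderiv : deriv (fun x => ∫ t in a'..x, θ t) = θ := funext fun x => (hd x).deriv
  have hzero : ∀ x, x ∉ Icc a' c' → ∫ t in a'..x, θ t = 0 := by
    intro x hx
    rcases lt_or_ge x a' with hxa | hxa
    · rw [intervalIntegral.integral_symm, intervalIntegral.integral_of_le hxa.le,
        ← integral_Ico_eq_integral_Ioc, setIntegral_eq_zero_of_forall_eq_zero, neg_zero]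
      exact fun t ht => hz t fun h => absurd ht.2 (not_lt.2 h.1)
    · have hxc : c' < x := by
        by_contra h
        exact hx ⟨hxa, not_lt.1 h⟩
      rw [intervalIntegral.integral_of_le hxa, ← integral_Icc_eq_integral_Ioc,
        setIntegral_eq_integral_of_forall_compl_eq_zero, h0]
      exact fun t ht => hz t fun h => ht ⟨h.1, h.2.trans hxc.le⟩
  have hsupp : tsupport (fun x => ∫ t in a'..x, θ t) ⊆ Icc a' c' :=
    closure_minimal (fun x hx => by_contra fun h => hx (hzero x h)) isClosed_Icc
  refine ⟨_, ⟨?_, ?_, hsupp.trans hsub⟩, hderiv⟩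
  · rw [contDiff_infty_iff_deriv, hderiv]
    exact ⟨fun x => (hd x).differentiableAt, hθ.1⟩
  · exact isCompact_Icc.of_isClosed_subset (isClosed_tsupport _) hsupp

theorem exists_testFunction_integral_eq_one {a c : ℝ} (hac : a < c) :
    ∃ φ, IsTestFunction (Ioo a c) φ ∧ ∫ x, φ x = 1 := by
  let B : ContDiffBump ((a + c) / 2) := ⟨(c - a) / 8, (c - a) / 4, by linarith, by linarith⟩
  refine ⟨B.normed volume, ⟨B.contDiff_normed, B.hasCompactSupport_normed, ?_⟩, B.integral_normed⟩
  rw [B.tsupport_normed_eq, Real.closedBall_eq_Icc]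
  intro x hx
  have h1 : B.rOut = (c - a) / 4 := rfl
  rw [h1] at hx
  exact ⟨by linarith [hx.1], by linarith [hx.2]⟩

/-- The du Bois-Reymond lemma: a function with vanishing weak derivative is constant. -/
theorem ae_eq_const_of_isWeakDeriv_zero {a c : ℝ} (hac : a < c) {f : ℝ → ℝ}
    (h : IsWeakDeriv (Ioo a c) f 0) : ∃ C : ℝ, f =ᵐ[volume.restrict (Ioo a c)] fun _ => C := by
  obtain ⟨φ₀, hφ₀, hφ₀1⟩ := exists_testFunction_integral_eq_one hac
  refine ⟨∫ x, f x * φ₀ x, ae_eq_of_forall_testFunction isOpen_Ioo h.1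
    (locallyIntegrableOn_const _) fun φ hφ => ?_⟩
  have hiφ : Integrable φ := hφ.continuous.integrable_of_hasCompactSupport hφ.2.1
  have hiφ₀ : Integrable φ₀ := hφ₀.continuous.integrable_of_hasCompactSupport hφ₀.2.1
  have hcs : HasCompactSupport fun x => (∫ y, φ y) * φ₀ x := hφ₀.2.1.mul_left
  -- Subtracting the multiple of `φ₀` with the same integral leaves a function of mean zero, hence
  -- the derivative of a test function.
  have hθ : IsTestFunction (Ioo a c) (fun x => φ x - (∫ y, φ y) * φ₀ x) := by
    refine ⟨hφ.1.sub (contDiff_const.mul hφ₀.1), hφ.2.1.sub hcs, ?_⟩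
    refine (tsupport_sub φ _).trans (union_subset hφ.2.2 ?_)
    exact (tsupport_mul_subset_right).trans hφ₀.2.2
  obtain ⟨ψ, hψ, hψ'⟩ := exists_testFunction_primitive hθ (by
    rw [integral_sub hiφ (hiφ₀.const_mul _), integral_const_mul, hφ₀1, mul_one, sub_self])
  have h2 := h.2.2 ψ hψ
  rw [hψ', hθ.setIntegral_mul] at h2
  rw [hφ.setIntegral_mul, hφ.setIntegral_mul, integral_const_mul]
  have h3 : ∫ x, (f x * φ x - (∫ y, φ y) * (f x * φ₀ x)) = 0 := by
    rw [← neg_zero]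
    refine Eq.trans ?_ (h2.trans (by simp))
    congr 1 with x
    ring
  rw [integral_sub (hφ.integrable_mul h.1) ((hφ₀.integrable_mul h.1).const_mul _),
    integral_const_mul, sub_eq_zero] at h3
  rw [h3, mul_comm]

/-- Both sides have the same weak derivative, so they differ by a constant, and the constant is seen
to be zero on `(a, d)`. Vanishing on `(-δ, 0]` thus plays the role of the clamping conditions at
`0`. -/
theorem IsWeakDeriv.ae_eq_primitive {a d c : ℝ} (had : a < d) (hdc : d ≤ c) {f g : ℝ → ℝ}
    (h : IsWeakDeriv (Ioo a c) f g) (hg : IntegrableOn g (Ioo a c))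
    (hf : f =ᵐ[volume.restrict (Ioo a d)] 0) :
    f =ᵐ[volume.restrict (Ioo a c)] fun x => ∫ t in a..x, g t := by
  have hac : a < c := had.trans_le hdc
  have hsub : Ioo a d ⊆ Ioo a c := Ioo_subset_Ioo_right hdc
  obtain ⟨C, hC⟩ := ae_eq_const_of_isWeakDeriv_zero hac
    ((h.sub (isWeakDeriv_primitive hac.le hg)).congr (g₂ := 0) .rfl (by simp; rfl))
  have hg0 : g =ᵐ[volume.restrict (Ioo a d)] 0 :=
    ae_eq_zero_of_isWeakDeriv isOpen_Ioo (h.mono hsub) hf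
  have hG : ∀ x ∈ Ioo a d, ∫ t in a..x, g t = 0 := by
    intro x hx
    rw [intervalIntegral.integral_of_le hx.1.le]
    refine integral_eq_zero_of_ae (ae_mono (Measure.restrict_mono ?_ le_rfl) hg0)
    exact fun t ht => ⟨ht.1, ht.2.trans_lt hx.2⟩
  have hC0 : C = 0 := by
    have h1 : ∀ᵐ x ∂volume.restrict (Ioo a d), C = 0 := by
      filter_upwards [ae_mono (Measure.restrict_mono hsub le_rfl) hC, hf,
        ae_restrict_mem measurableSet_Ioo] with x h1 h2 h3
      rw [← h1, h2, hG x h3]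
      simp
    have : (ae (volume.restrict (Ioo a d))).NeBot := by
      rw [ae_neBot, Ne, Measure.restrict_eq_zero, Real.volume_Ioo]
      simpa using had
    exact h1.exists.choose_spec
  filter_upwards [hC] with x hx
  rw [hC0] at hx
  exact sub_eq_zero.1 hx

/-! ### Parametrizations of the Cantor set and of its approximations -/

theorem map_affine_restrict_volume {a : ℝ} (ha : a ≠ 0) (d : ℝ) (S : Set ℝ) :
    (volume.restrict S).map (fun x => a * x + d) =
      ENNReal.ofReal |a⁻¹| • volume.restrict ((fun x => a * x + d) '' S) := by
  have he : MeasurableEmbedding (fun x : ℝ => a * x + d) :=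
    (measurableEmbedding_addRight d).comp (measurableEmbedding_mulLeft₀ ha)
  have hv : (volume : Measure ℝ).map (fun x => a * x + d) = ENNReal.ofReal |a⁻¹| • volume := by
    have : (fun x : ℝ => a * x + d) = (fun x => x + d) ∘ (fun x => a * x) := rfl
    rw [this, ← Measure.map_map (measurable_add_const d) (measurable_const_mul a),
      Real.map_volume_mul_left ha, Measure.map_smul, map_add_right_eq_self]
  rw [← Measure.restrict_smul, ← hv, he.restrict_map, preimage_image_eq _ he.injective]

theorem measurableSet_cantorStep (ℓ : ℝ) (n : ℕ) : MeasurableSet (cantorStep ℓ n) := by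
  have : IsCompact (cantorStep ℓ n) := by
    induction n with
    | zero => exact isCompact_Icc
    | succ n ih => exact (ih.image (by fun_prop)).union (ih.image (by fun_prop))
  exact this.measurableSet

theorem isClosed_cantorStep (ℓ : ℝ) (n : ℕ) : IsClosed (cantorStep ℓ n) := by
  have : IsCompact (cantorStep ℓ n) := by
    induction n with
    | zero => exact isCompact_Icc
    | succ n ih => exact (ih.image (by fun_prop)).union (ih.image (by fun_prop))
  exact this.isClosed

theorem cantorStep_succ_subset {ℓ : ℝ} (hℓ : 0 < ℓ) (n : ℕ) :
    cantorStep ℓ (n + 1) ⊆ cantorStep ℓ n := by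
  induction n with
  | zero =>
    rintro _ (⟨x, hx, rfl⟩ | ⟨x, hx, rfl⟩)
    · exact ⟨by have := hx.1; positivity, by simp only; linarith [hx.2]⟩
    · exact ⟨by have := hx.1; positivity, by simp only; linarith [hx.2]⟩
  | succ n ih => exact union_subset_union (image_mono ih) (image_mono ih)

theorem antitone_cantorStep {ℓ : ℝ} (hℓ : 0 < ℓ) : Antitone (cantorStep ℓ) :=
  antitone_nat_of_succ_le (cantorStep_succ_subset hℓ)

theorem cantorStep_subset_Icc {ℓ : ℝ} (hℓ : 0 < ℓ) (n : ℕ) : cantorStep ℓ n ⊆ Icc 0 ℓ :=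
  antitone_cantorStep hℓ (Nat.zero_le n)

/-- The piecewise affine parametrization of `C_n` by `[0, ℓ]` with slope `(2/3)^n`. -/
noncomputable def cantorParam (ℓ : ℝ) : ℕ → ℝ → ℝ
  | 0, y => y
  | n + 1, y => if y < ℓ / 2 then cantorParam ℓ n (2 * y) / 3
      else (cantorParam ℓ n (2 * y - ℓ) + 2 * ℓ) / 3

theorem measurable_cantorParam (ℓ : ℝ) (n : ℕ) : Measurable (cantorParam ℓ n) := by
  induction n with
  | zero => exact measurable_id
  | succ n ih =>
    refine Measurable.ite measurableSet_Iio ?_ ?_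
    · exact (ih.comp (by fun_prop)).div_const 3
    · exact ((ih.comp (by fun_prop)).add_const _).div_const 3

theorem two_mul_mem {ℓ y : ℝ} (hy : y ∈ Ico 0 ℓ) (h : y < ℓ / 2) : 2 * y ∈ Ico 0 ℓ :=
  ⟨by linarith [hy.1], by linarith⟩

theorem two_mul_sub_mem {ℓ y : ℝ} (hy : y ∈ Ico 0 ℓ) (h : ¬y < ℓ / 2) : 2 * y - ℓ ∈ Ico 0 ℓ :=
  ⟨by linarith, by linarith [hy.2]⟩

theorem cantorParam_mem {ℓ : ℝ} (n : ℕ) {y : ℝ} (hy : y ∈ Ico 0 ℓ) :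
    cantorParam ℓ n y ∈ cantorStep ℓ n := by
  induction n generalizing y with
  | zero => exact ⟨hy.1, hy.2.le⟩
  | succ n ih =>
    rw [cantorParam]
    split_ifs with h
    · exact Or.inl ⟨_, ih (two_mul_mem hy h), rfl⟩
    · exact Or.inr ⟨_, ih (two_mul_sub_mem hy h), rfl⟩

/-- Each level of the recursion contracts distances by `3`; at level `0` both points lie in `[0,
ℓ]`. -/
theorem dist_cantorParam_succ {ℓ : ℝ} (hℓ : 0 < ℓ) (n : ℕ) {y : ℝ} (hy : y ∈ Ico 0 ℓ) :
    dist (cantorParam ℓ n y) (cantorParam ℓ (n + 1) y) ≤ ℓ * (1 / 3) ^ n := by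
  induction n generalizing y with
  | zero =>
    have h1 := cantorStep_subset_Icc hℓ 1 (cantorParam_mem 1 hy)
    rw [Real.dist_eq, abs_le]
    simp only [cantorParam, pow_zero, mul_one] at h1 ⊢
    constructor <;> linarith [h1.1, h1.2, hy.1, hy.2]
  | succ n ih =>
    rw [cantorParam, cantorParam.eq_def ℓ (n + 1 + 1)]
    simp only
    split_ifs with h
    · have := ih (two_mul_mem hy h)
      rw [Real.dist_eq] at this ⊢
      rw [← sub_div, abs_div, abs_of_pos (by norm_num : (0 : ℝ) < 3), pow_succ]
      linarith
    · have := ih (two_mul_sub_mem hy h)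
      rw [Real.dist_eq] at this ⊢
      rw [← sub_div, abs_div, abs_of_pos (by norm_num : (0 : ℝ) < 3), pow_succ,
        add_sub_add_right_eq_sub]
      linarith

theorem volume_restrict_Ico_half {ℓ : ℝ} (hℓ : 0 < ℓ) : (volume : Measure ℝ).restrict (Ico 0 ℓ) =
    volume.restrict (Ico 0 (ℓ / 2)) + volume.restrict (Ico (ℓ / 2) ℓ) := by
  rw [← Measure.restrict_union _ measurableSet_Ico,
    Ico_union_Ico_eq_Ico (by linarith) (by linarith)]
  exact disjoint_left.2 fun x hx hx' => absurd hx.2 (not_lt.2 hx'.1)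

/-- On each half of `[0, ℓ)`, doubling the parameter contributes a factor `1/2` and dividing the
image by `3` a factor `3`, so every level multiplies the density by `3/2`. -/
theorem map_cantorParam {ℓ : ℝ} (hℓ : 0 < ℓ) (n : ℕ) :
    (volume.restrict (Ico 0 ℓ)).map (cantorParam ℓ n) =
      ENNReal.ofReal ((3 / 2) ^ n) • volume.restrict (cantorStep ℓ n) := by
  induction n with
  | zero =>
    have : cantorParam ℓ 0 = id := rfl
    rw [this, Measure.map_id]
    simpa [cantorStep] using Measure.restrict_congr_set Ico_ae_eq_Icc
  | succ n ih =>
    have hm := measurable_cantorParam ℓ n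
    have hL : (volume.restrict (Ico 0 (ℓ / 2))).map (cantorParam ℓ (n + 1)) =
        ENNReal.ofReal ((3 / 2) ^ (n + 1)) •
          volume.restrict ((fun x => x / 3) '' cantorStep ℓ n) := by
      have h1 : (volume.restrict (Ico 0 (ℓ / 2))).map (cantorParam ℓ (n + 1)) =
          (volume.restrict (Ico 0 (ℓ / 2))).map
            ((fun x => 3⁻¹ * x + 0) ∘ cantorParam ℓ n ∘ (fun y => 2 * y + 0)) := by
        refine Measure.map_congr ?_
        filter_upwards [ae_restrict_mem measurableSet_Ico] with y hy
        simp only [cantorParam, Function.comp, if_pos hy.2, add_zero]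
        ring
      have h2 : (fun y : ℝ => 2 * y + 0) '' Ico 0 (ℓ / 2) = Ico 0 ℓ := by
        rw [image_affine_Ico (by norm_num)]
        congr 1 <;> ring
      have h3 : (fun x : ℝ => x / 3) = fun x => 3⁻¹ * x + 0 := by
        ext x; ring
      rw [h1, ← Measure.map_map (by fun_prop) (hm.comp (by fun_prop)),
        ← Measure.map_map hm (by fun_prop), map_affine_restrict_volume (by norm_num), h2,
        Measure.map_smul, ih, Measure.map_smul, Measure.map_smul,
        map_affine_restrict_volume (by norm_num), h3, smul_smul, smul_smul,
        ← ENNReal.ofReal_mul (by positivity), ← ENNReal.ofReal_mul (by positivity)]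
      congr 2
      rw [pow_succ]
      norm_num
      ring
    have hR : (volume.restrict (Ico (ℓ / 2) ℓ)).map (cantorParam ℓ (n + 1)) =
        ENNReal.ofReal ((3 / 2) ^ (n + 1)) •
          volume.restrict ((fun x => (x + 2 * ℓ) / 3) '' cantorStep ℓ n) := by
      have h1 : (volume.restrict (Ico (ℓ / 2) ℓ)).map (cantorParam ℓ (n + 1)) =
          (volume.restrict (Ico (ℓ / 2) ℓ)).map
            ((fun x => 3⁻¹ * x + 2 * ℓ / 3) ∘ cantorParam ℓ n ∘ (fun y => 2 * y + -ℓ)) := by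
        refine Measure.map_congr ?_
        filter_upwards [ae_restrict_mem measurableSet_Ico] with y hy
        simp only [cantorParam, Function.comp, if_neg (not_lt.2 hy.1), ← sub_eq_add_neg]
        ring
      have h2 : (fun y : ℝ => 2 * y + -ℓ) '' Ico (ℓ / 2) ℓ = Ico 0 ℓ := by
        rw [image_affine_Ico (by norm_num)]
        congr 1 <;> ring
      have h3 : (fun x : ℝ => (x + 2 * ℓ) / 3) = fun x => 3⁻¹ * x + 2 * ℓ / 3 := by
        ext x; ring
      rw [h1, ← Measure.map_map (by fun_prop) (hm.comp (by fun_prop)),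
        ← Measure.map_map hm (by fun_prop), map_affine_restrict_volume (by norm_num), h2,
        Measure.map_smul, ih, Measure.map_smul, Measure.map_smul,
        map_affine_restrict_volume (by norm_num), h3, smul_smul, smul_smul,
        ← ENNReal.ofReal_mul (by positivity), ← ENNReal.ofReal_mul (by positivity)]
      congr 2
      rw [pow_succ]
      norm_num
      ring
    have hS : MeasurableSet ((fun x => (x + 2 * ℓ) / 3) '' cantorStep ℓ n) := by
      have h3 : (fun x : ℝ => (x + 2 * ℓ) / 3) = fun x => 3⁻¹ * (x + 2 * ℓ) := by
        ext x; ring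
      rw [h3]
      exact ((measurableEmbedding_mulLeft₀ (by norm_num : (3⁻¹ : ℝ) ≠ 0)).comp
        (measurableEmbedding_addRight (2 * ℓ))).measurableSet_image.2
          (measurableSet_cantorStep ℓ n)
    rw [volume_restrict_Ico_half hℓ, Measure.map_add _ _ (measurable_cantorParam ℓ _), hL, hR,
      cantorStep, Measure.restrict_union _ hS, smul_add]
    rw [disjoint_left]
    rintro _ ⟨x, hx, rfl⟩ ⟨y, hy, h⟩
    have h1 := cantorStep_subset_Icc hℓ n hx
    have h2 := cantorStep_subset_Icc hℓ n hy
    simp only at h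
    linarith [h1.2, h2.1]

/-! ### The limiting parametrization and its mass on small sets -/

/-- The limit of the parametrizations `cantorParam ℓ n`: the inverse of the Cantor function. -/
noncomputable def cantorMap (ℓ : ℝ) (y : ℝ) : ℝ :=
  limUnder atTop fun n => (Ico 0 ℓ).indicator (cantorParam ℓ n) y

/-- The cutoff to `[0, ℓ)` yields convergence at every `y`, so that measurability passes to the
limit. -/
theorem tendsto_indicator_cantorParam {ℓ : ℝ} (hℓ : 0 < ℓ) (y : ℝ) :
    Tendsto (fun n => (Ico 0 ℓ).indicator (cantorParam ℓ n) y) atTop (𝓝 (cantorMap ℓ y)) := by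
  refine CauchySeq.tendsto_limUnder ?_
  refine cauchySeq_of_le_geometric (1 / 3) ℓ (by norm_num) fun n => ?_
  by_cases hy : y ∈ Ico 0 ℓ
  · simpa only [indicator_of_mem hy] using dist_cantorParam_succ hℓ n hy
  · simp only [indicator_of_notMem hy, dist_self]
    positivity

theorem tendsto_cantorParam {ℓ : ℝ} (hℓ : 0 < ℓ) {y : ℝ} (hy : y ∈ Ico 0 ℓ) :
    Tendsto (fun n => cantorParam ℓ n y) atTop (𝓝 (cantorMap ℓ y)) := by
  simpa only [indicator_of_mem hy] using tendsto_indicator_cantorParam hℓ y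

theorem measurable_cantorMap {ℓ : ℝ} (hℓ : 0 < ℓ) : Measurable (cantorMap ℓ) :=
  measurable_of_tendsto_metrizable
    (fun n => (measurable_cantorParam ℓ n).indicator measurableSet_Ico)
    (tendsto_pi_nhds.2 (tendsto_indicator_cantorParam hℓ))

theorem cantorMap_mem {ℓ : ℝ} (hℓ : 0 < ℓ) {y : ℝ} (hy : y ∈ Ico 0 ℓ) :
    cantorMap ℓ y ∈ beamCantorSet ℓ := by
  refine mem_iInter.2 fun n => (isClosed_cantorStep ℓ n).mem_of_tendsto (tendsto_cantorParam hℓ hy) ?_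
  filter_upwards [eventually_ge_atTop n] with m hm
  exact antitone_cantorStep hℓ hm (cantorParam_mem m hy)

theorem cantorMap_mem_Icc {ℓ : ℝ} (hℓ : 0 < ℓ) {y : ℝ} (hy : y ∈ Ico 0 ℓ) :
    cantorMap ℓ y ∈ Icc 0 ℓ :=
  mem_iInter.1 (cantorMap_mem hℓ hy) 0

theorem cantorMap_of_lt {ℓ : ℝ} (hℓ : 0 < ℓ) {y : ℝ} (hy : y ∈ Ico 0 ℓ) (h : y < ℓ / 2) :
    cantorMap ℓ y = cantorMap ℓ (2 * y) / 3 := by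
  refine tendsto_nhds_unique ((tendsto_cantorParam hℓ hy).comp (tendsto_add_atTop_nat 1)) ?_
  refine ((tendsto_cantorParam hℓ (two_mul_mem hy h)).div_const 3).congr fun n => ?_
  simp [cantorParam, h]

theorem cantorMap_of_not_lt {ℓ : ℝ} (hℓ : 0 < ℓ) {y : ℝ} (hy : y ∈ Ico 0 ℓ) (h : ¬y < ℓ / 2) :
    cantorMap ℓ y = (cantorMap ℓ (2 * y - ℓ) + 2 * ℓ) / 3 := by
  refine tendsto_nhds_unique ((tendsto_cantorParam hℓ hy).comp (tendsto_add_atTop_nat 1)) ?_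
  refine (((tendsto_cantorParam hℓ (two_mul_sub_mem hy h)).add_const (2 * ℓ)).div_const 3).congr
    fun n => ?_
  simp [cantorParam, h]

/-- A set of diameter less than `3⁻ᵏ ℓ` carries at most the mass of one interval of `C_k`. -/
theorem volume_cantorMap_preimage_le {ℓ : ℝ} (hℓ : 0 < ℓ) (k : ℕ) (A : Set ℝ)
    (hA : ∀ x ∈ A, ∀ y ∈ A, x - y < ℓ * (1 / 3) ^ k) :
    volume (Ico 0 ℓ ∩ cantorMap ℓ ⁻¹' A) ≤ ENNReal.ofReal (ℓ * (1 / 2) ^ k) := by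
  induction k generalizing A with
  | zero =>
    refine (measure_mono inter_subset_left).trans ?_
    simp
  | succ k ih =>
    have hhalf : ENNReal.ofReal |(2 : ℝ)⁻¹| * ENNReal.ofReal (ℓ * (1 / 2) ^ k) =
        ENNReal.ofReal (ℓ * (1 / 2) ^ (k + 1)) := by
      rw [← ENNReal.ofReal_mul (by positivity), abs_of_pos (by norm_num)]
      ring_nf
    -- Points from the left and right halves are mapped at least `ℓ / 3` apart, so the strict
    -- diameter bound confines `A` to one of the two copies; rescaling that copy by `3` reduces to
    -- `k`.
    by_cases h : ∃ y ∈ Ico 0 ℓ, y < ℓ / 2 ∧ cantorMap ℓ y ∈ A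
    · obtain ⟨y₀, hy₀, hlt, hmem⟩ := h
      have hy1 : cantorMap ℓ y₀ ≤ ℓ / 3 := by
        rw [cantorMap_of_lt hℓ hy₀ hlt]
        linarith [(cantorMap_mem_Icc hℓ (two_mul_mem hy₀ hlt)).2]
      have hsub : Ico 0 ℓ ∩ cantorMap ℓ ⁻¹' A ⊆
          (2 * ·) ⁻¹' (Ico 0 ℓ ∩ cantorMap ℓ ⁻¹' ((fun x => x / 3) ⁻¹' A)) := by
        rintro y ⟨hy, hyA⟩
        by_cases hl : y < ℓ / 2
        · refine ⟨two_mul_mem hy hl, ?_⟩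
          rwa [mem_preimage, mem_preimage, ← cantorMap_of_lt hℓ hy hl]
        · exfalso
          have h1 := hA _ hyA _ hmem
          rw [cantorMap_of_not_lt hℓ hy hl] at h1
          have h2 := (cantorMap_mem_Icc hℓ (two_mul_sub_mem hy hl)).1
          have h3 : ((1 : ℝ) / 3) ^ (k + 1) ≤ 1 / 3 := by
            rw [pow_succ]
            have : ((1 : ℝ) / 3) ^ k ≤ 1 := pow_le_one₀ (by norm_num) (by norm_num)
            linarith
          nlinarith
      refine (measure_mono hsub).trans ?_
      rw [Real.volume_preimage_mul_left (by norm_num), ← hhalf]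
      gcongr
      refine ih _ fun x hx y hy => ?_
      have := hA _ hx _ hy
      rw [pow_succ] at this
      simp only at this
      linarith
    · have hsub : Ico 0 ℓ ∩ cantorMap ℓ ⁻¹' A ⊆ (2 * ·) ⁻¹' ((· + -ℓ) ⁻¹'
          (Ico 0 ℓ ∩ cantorMap ℓ ⁻¹' ((fun x => (x + 2 * ℓ) / 3) ⁻¹' A))) := by
        rintro y ⟨hy, hyA : cantorMap ℓ y ∈ A⟩
        have hl : ¬y < ℓ / 2 := fun hl => h ⟨y, hy, hl, hyA⟩
        refine ⟨?_, ?_⟩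
        · simpa only [← sub_eq_add_neg] using two_mul_sub_mem hy hl
        · rw [cantorMap_of_not_lt hℓ hy hl, sub_eq_add_neg] at hyA
          exact hyA
      refine (measure_mono hsub).trans ?_
      rw [Real.volume_preimage_mul_left (by norm_num), measure_preimage_add_right, ← hhalf]
      gcongr
      refine ih _ fun x hx y hy => ?_
      have := hA _ hx _ hy
      rw [pow_succ] at this
      simp only at this
      linarith

/-- The image measure has no atoms: let `k → ∞` in the preceding bound. -/
theorem volume_cantorMap_preimage_subsingleton {ℓ : ℝ} (hℓ : 0 < ℓ) {A : Set ℝ}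
    (hA : A.Subsingleton) : volume (Ico 0 ℓ ∩ cantorMap ℓ ⁻¹' A) = 0 := by
  have h : Tendsto (fun k : ℕ => ENNReal.ofReal (ℓ * (1 / 2) ^ k)) atTop (𝓝 0) := by
    rw [← ENNReal.ofReal_zero]
    refine ENNReal.tendsto_ofReal ?_
    simpa using (tendsto_pow_atTop_nhds_zero_of_lt_one (by norm_num : (0 : ℝ) ≤ 1 / 2)
      (by norm_num)).const_mul ℓ
  refine le_antisymm (ge_of_tendsto' h fun k => volume_cantorMap_preimage_le hℓ k A ?_) zero_le
  intro x hx y hy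
  rw [hA hx hy, sub_self]
  positivity

/-! ### Comparison with Hausdorff measure -/

theorem cantorDim_pos : 0 < cantorDim := div_pos (Real.log_pos (by norm_num)) (Real.log_pos (by norm_num))

theorem three_rpow_cantorDim : (3 : ℝ) ^ cantorDim = 2 := by
  rw [cantorDim, Real.rpow_def_of_pos (by norm_num), mul_div_cancel₀, Real.exp_log (by norm_num)]
  exact (Real.log_pos (by norm_num)).ne'

theorem third_pow_rpow_cantorDim (k : ℕ) : (((1 : ℝ) / 3) ^ k) ^ cantorDim = (1 / 2) ^ k := by
  rw [← Real.rpow_natCast, ← Real.rpow_mul (by norm_num), mul_comm, Real.rpow_mul (by norm_num),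
    Real.div_rpow (by norm_num) (by norm_num), three_rpow_cantorDim, Real.one_rpow,
    Real.rpow_natCast]

/-- The push-forward of Lebesgue measure on the Cantor set is dominated by Hausdorff measure. -/
theorem map_cantorMap_le {ℓ : ℝ} (hℓ : 0 < ℓ) : ∃ c : ℝ≥0∞, c ≠ 0 ∧
    c • (volume.restrict (Ico 0 ℓ)).map (cantorMap ℓ) ≤ μH[cantorDim] := by
  have hs := cantorDim_pos
  -- For a set of diameter `d`, choose `k` with `3^{-(k+1)} < 2d/ℓ ≤ 3^{-k}`; the factor `2` makes
  -- `d < ℓ 3⁻ᵏ` strict. The mass is then at most `ℓ 2⁻ᵏ = 2ℓ (3^{-(k+1)})^s ≤ 2ℓ (2d/ℓ)^s = K d^s`.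
  set K : ℝ := 2 * ℓ * (2 / ℓ) ^ cantorDim with hK
  have hKpos : 0 < K := by positivity
  refine ⟨(ENNReal.ofReal K)⁻¹, by simp, ?_⟩
  refine Measure.le_hausdorffMeasure _ _ (ENNReal.ofReal (ℓ / 2)) (by simpa using hℓ) fun A hA => ?_
  have hcl : MeasurableSet (closure A) := isClosed_closure.measurableSet
  -- Passing to the closure gains measurability without changing the diameter.
  refine (measure_mono subset_closure).trans ?_
  rw [← Metric.ediam_closure] at hA ⊢
  set B := closure A
  rw [Measure.smul_apply, Measure.map_apply (measurable_cantorMap hℓ) hcl,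
    Measure.restrict_apply (measurable_cantorMap hℓ hcl), inter_comm, smul_eq_mul]
  rcases eq_or_ne (Metric.ediam B) 0 with h0 | h0
  · rw [volume_cantorMap_preimage_subsingleton hℓ (Metric.ediam_eq_zero_iff.1 h0)]
    simp
  have htop : Metric.ediam B ≠ ⊤ := ne_top_of_le_ne_top ENNReal.ofReal_ne_top hA
  set d := (Metric.ediam B).toReal with hd
  have hdpos : 0 < d := ENNReal.toReal_pos h0 htop
  have hdB : Metric.ediam B = ENNReal.ofReal d := (ENNReal.ofReal_toReal htop).symm
  have hdle : d ≤ ℓ / 2 := by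
    rw [hdB] at hA
    exact (ENNReal.ofReal_le_ofReal_iff (by positivity)).1 hA
  obtain ⟨k, hk1, hk2⟩ := exists_nat_pow_near_of_lt_one (x := 2 * d / ℓ) (y := 1 / 3)
    (by positivity) (by rw [div_le_one hℓ]; linarith) (by norm_num) (by norm_num)
  have hvol := volume_cantorMap_preimage_le hℓ k B (fun x hx y hy => by
    have h1 : edist x y ≤ ENNReal.ofReal d := hdB ▸ Metric.edist_le_ediam_of_mem hx hy
    rw [edist_dist, ENNReal.ofReal_le_ofReal_iff hdpos.le, Real.dist_eq] at h1
    rw [div_le_iff₀ hℓ] at hk2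
    linarith [le_abs_self (x - y)])
  have hfin : ℓ * (1 / 2) ^ k ≤ K * d ^ cantorDim := by
    have h1 := Real.rpow_le_rpow (by positivity) hk1.le hs.le
    rw [third_pow_rpow_cantorDim, show 2 * d / ℓ = 2 / ℓ * d by ring,
      Real.mul_rpow (by positivity) hdpos.le, pow_succ] at h1
    rw [hK]
    nlinarith
  calc _ ≤ (ENNReal.ofReal K)⁻¹ * ENNReal.ofReal (K * d ^ cantorDim) := by
        gcongr
        exact hvol.trans (ENNReal.ofReal_le_ofReal hfin)
    _ = Metric.ediam B ^ cantorDim := by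
        rw [ENNReal.ofReal_mul hKpos.le, ← mul_assoc, ENNReal.inv_mul_cancel (by simpa using hKpos)
          ENNReal.ofReal_ne_top, one_mul, hdB, ENNReal.ofReal_rpow_of_pos hdpos]

theorem exists_cover_cantorStep (ℓ : ℝ) (n : ℕ) : ∃ S : Finset ℝ, S.card ≤ 2 ^ n ∧
    cantorStep ℓ n ⊆ ⋃ a : S, Icc (a : ℝ) (a + ℓ * (1 / 3) ^ n) := by
  induction n with
  | zero => exact ⟨{0}, by simp, by
      intro x hx
      exact mem_iUnion.2 ⟨⟨0, by simp⟩, by simpa [cantorStep] using hx⟩⟩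
  | succ n ih =>
    obtain ⟨S, hS, hsub⟩ := ih
    refine ⟨S.image (fun x => x / 3) ∪ S.image (fun x => (x + 2 * ℓ) / 3), ?_, ?_⟩
    · refine (Finset.card_union_le _ _).trans ?_
      rw [pow_succ, mul_two]
      exact add_le_add (Finset.card_image_le.trans hS) (Finset.card_image_le.trans hS)
    · rintro _ (⟨x, hx, rfl⟩ | ⟨x, hx, rfl⟩)
      · obtain ⟨⟨a, ha⟩, h1, h2⟩ := mem_iUnion.1 (hsub hx)
        refine mem_iUnion.2 ⟨⟨a / 3, Finset.mem_union_left _ (Finset.mem_image_of_mem _ ha)⟩, ?_⟩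
        rw [pow_succ]
        simp only at h1 h2 ⊢
        constructor <;> linarith
      · obtain ⟨⟨a, ha⟩, h1, h2⟩ := mem_iUnion.1 (hsub hx)
        refine mem_iUnion.2 ⟨⟨(a + 2 * ℓ) / 3,
          Finset.mem_union_right _ (Finset.mem_image.2 ⟨a, ha, rfl⟩)⟩, ?_⟩
        rw [pow_succ]
        simp only at h1 h2 ⊢
        constructor <;> linarith

/-- Cover by `2^n` intervals of length `ℓ 3⁻ⁿ`; since `3^s = 2`, the sums of `diam^s` are at most
`ℓ^s`. -/
theorem hausdorffMeasure_beamCantorSet_lt_top {ℓ : ℝ} (hℓ : 0 < ℓ) :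
    μH[cantorDim] (beamCantorSet ℓ) < ⊤ := by
  choose S hS hsub using exists_cover_cantorStep ℓ
  have hdiam : ∀ (n : ℕ) (a : S n), Metric.ediam (Icc (a : ℝ) (a + ℓ * (1 / 3) ^ n)) =
      ENNReal.ofReal (ℓ * (1 / 3) ^ n) := fun n a => by
    rw [Real.ediam_Icc, add_sub_cancel_left]
  have hr : Tendsto (fun n : ℕ => ENNReal.ofReal (ℓ * (1 / 3) ^ n)) atTop (𝓝 0) := by
    rw [← ENNReal.ofReal_zero]
    refine ENNReal.tendsto_ofReal ?_
    simpa using (tendsto_pow_atTop_nhds_zero_of_lt_one (by norm_num : (0 : ℝ) ≤ 1 / 3)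
      (by norm_num)).const_mul ℓ
  refine (Measure.hausdorffMeasure_le_liminf_sum (ι := fun n => S n) cantorDim (beamCantorSet ℓ)
    (l := atTop) _ hr (fun n a => Icc (a : ℝ) (a + ℓ * (1 / 3) ^ n))
    (Eventually.of_forall fun n a => (hdiam n a).le)
    (Eventually.of_forall fun n => (iInter_subset _ n).trans (hsub n))).trans_lt ?_
  have hb : ∀ n, ∑ a : S n, Metric.ediam (Icc (a : ℝ) (a + ℓ * (1 / 3) ^ n)) ^ cantorDim ≤
      ENNReal.ofReal (ℓ ^ cantorDim) := fun n => by
    simp only [hdiam, Finset.sum_const, Finset.card_univ, Fintype.card_coe, nsmul_eq_mul]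
    rw [ENNReal.ofReal_rpow_of_pos (by positivity), Real.mul_rpow hℓ.le (by positivity),
      third_pow_rpow_cantorDim, ← ENNReal.ofReal_natCast, ← ENNReal.ofReal_mul (by positivity)]
    refine ENNReal.ofReal_le_ofReal ?_
    have h1 : ((S n).card : ℝ) ≤ 2 ^ n := by exact_mod_cast hS n
    calc _ ≤ (2 : ℝ) ^ n * (ℓ ^ cantorDim * (1 / 2) ^ n) := by gcongr
      _ = ℓ ^ cantorDim * (2 * (1 / 2)) ^ n := by rw [mul_pow]; ring
      _ = ℓ ^ cantorDim := by norm_num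
  exact (liminf_le_of_le (by isBoundedDefault) fun b hb' =>
    let ⟨n, hn⟩ := hb'.exists; hn.trans (hb n)).trans_lt ENNReal.ofReal_lt_top

theorem volume_cantorMap_preimage_eq_zero {ℓ : ℝ} (hℓ : 0 < ℓ) {A : Set ℝ}
    (hA : MeasurableSet A) (h : cantorMeasure ℓ A = 0) :
    volume (Ico 0 ℓ ∩ cantorMap ℓ ⁻¹' A) = 0 := by
  rw [cantorMeasure, Measure.smul_apply, smul_eq_mul, mul_eq_zero] at h
  have h1 : μH[cantorDim] (A ∩ beamCantorSet ℓ) = 0 := by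
    rw [← Measure.restrict_apply hA]
    -- The normalizing factor is nonzero because `H^s(C) < ∞`; for infinite `H^s(C)` the quotient
    -- would be `0` and `η` would carry no information.
    refine h.resolve_left (ENNReal.div_ne_zero.2 ⟨by simpa using hℓ, ?_⟩)
    exact (hausdorffMeasure_beamCantorSet_lt_top hℓ).ne
  obtain ⟨c, hc, hle⟩ := map_cantorMap_le hℓ
  have hC : MeasurableSet (beamCantorSet ℓ) := .iInter (measurableSet_cantorStep ℓ)
  have h2 := le_antisymm ((hle (A ∩ beamCantorSet ℓ)).trans h1.le) zero_le
  rw [Measure.smul_apply, smul_eq_mul, mul_eq_zero, or_iff_right hc,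
    Measure.map_apply (measurable_cantorMap hℓ) (hA.inter hC),
    Measure.restrict_apply (measurable_cantorMap hℓ (hA.inter hC))] at h2
  refine measure_mono_null ?_ h2
  exact fun y hy => ⟨⟨hy.2, cantorMap_mem hℓ hy.1⟩, hy.1⟩

/-! ### Weak compactness in `L²` and integrals with respect to signed measures -/

theorem norm_toLp_sq {α : Type*} [MeasurableSpace α] {m : Measure α} {f : α → ℝ}
    (hf : MemLp f 2 m) : ‖hf.toLp f‖ ^ 2 = ∫ x, f x ^ 2 ∂m := by
  rw [← real_inner_self_eq_norm_sq, L2.inner_def]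
  refine integral_congr_ae ?_
  filter_upwards [hf.coeFn_toLp] with x hx
  simp [hx]

theorem inner_toLp {α : Type*} [MeasurableSpace α] {m : Measure α} {f g : α → ℝ}
    (hf : MemLp f 2 m) (hg : MemLp g 2 m) :
    inner ℝ (hf.toLp f) (hg.toLp g) = ∫ x, g x * f x ∂m := by
  rw [L2.inner_def]
  refine integral_congr_ae ?_
  filter_upwards [hf.coeFn_toLp, hg.coeFn_toLp] with x hx hx'
  simp [hx, hx']

/-- A bounded sequence in `L²` has a subsequence whose products with boundedly a.e. convergent
sequences have convergent integrals. -/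
theorem exists_subseq_tendsto_integral_mul {α : Type*} [MeasurableSpace α]
    [MeasurableSpace.CountablyGenerated α] {m : Measure α} [IsFiniteMeasure m] {k : ℕ → α → ℝ}
    (hk : ∀ n, MemLp (k n) 2 m) {K : ℝ} (hK : ∀ n, ∫ x, k n x ^ 2 ∂m ≤ K) :
    ∃ σ : ℕ → ℕ, StrictMono σ ∧ ∃ k' : α → ℝ, MemLp k' 2 m ∧
      ∀ (g : ℕ → α → ℝ) (g' : α → ℝ) (B : ℝ), (∀ n, AEStronglyMeasurable (g n) m) →
        (∀ n, ∀ᵐ x ∂m, |g n x| ≤ B) →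
        (∀ᵐ x ∂m, Tendsto (fun n => g n x) atTop (𝓝 (g' x))) →
        Tendsto (fun n => ∫ x, g (σ n) x * k (σ n) x ∂m) atTop (𝓝 (∫ x, g' x * k' x ∂m)) := by
  have : Fact ((2 : ℝ≥0∞) ≠ ⊤) := ⟨by norm_num⟩
  -- Sequential Banach–Alaoglu, using separability of `L²`; Riesz representation turns the limit
  -- functional into a function.
  have hball := WeakDual.isSeqCompact_closedBall ℝ (Lp ℝ 2 m) 0 (√K)
  have hnorm : ∀ n, ‖(hk n).toLp (k n)‖ ≤ √K := fun n => by
    refine Real.le_sqrt_of_sq_le ?_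
    rw [norm_toLp_sq]
    exact hK n
  obtain ⟨φ, -, σ, hσ, hlim⟩ := @hball
    (fun n => WeakDual.toStrongDual.symm (InnerProductSpace.toDual ℝ (Lp ℝ 2 m) ((hk n).toLp (k n))))
    (fun n => by simpa using hnorm n)
  set f' : Lp ℝ 2 m := (InnerProductSpace.toDual ℝ (Lp ℝ 2 m)).symm (WeakDual.toStrongDual φ)
    with hf'
  have hweak : ∀ x : Lp ℝ 2 m, Tendsto (fun n => inner ℝ ((hk (σ n)).toLp (k (σ n))) x) atTop
      (𝓝 (inner ℝ f' x)) := fun x => by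
    have := ((WeakDual.eval_continuous x).tendsto φ).comp hlim
    rw [hf', InnerProductSpace.toDual_symm_apply]
    exact this
  -- The subsequence is fixed before `g` is given, so a single `σ` serves all test sequences.
  refine ⟨σ, hσ, f', Lp.memLp f', fun g g' B hg hB hgg' => ?_⟩
  have hg' : AEStronglyMeasurable g' m := aestronglyMeasurable_of_tendsto_ae _ hg hgg'
  have hB' : ∀ᵐ x ∂m, |g' x| ≤ B := by
    filter_upwards [hgg', ae_all_iff.2 hB] with x hx hx'
    exact le_of_tendsto' hx.abs hx'
  have hG : ∀ n, MemLp (g n) 2 m := fun n => MemLp.of_bound (hg n) B (hB n)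
  have hG' : MemLp g' 2 m := MemLp.of_bound hg' B hB'
  have hstrong : Tendsto (fun n => ‖(hG n).toLp (g n) - hG'.toLp g'‖) atTop (𝓝 0) := by
    have h1 : Tendsto (fun n => ∫ x, (g n x - g' x) ^ 2 ∂m) atTop (𝓝 (∫ _, (0 : ℝ) ∂m)) := by
      refine tendsto_integral_of_dominated_convergence (fun _ => (B + B) ^ 2)
        (fun n => ((hg n).sub hg').pow 2) (integrable_const _) (fun n => ?_) ?_
      · filter_upwards [hB n, hB'] with x h1 h2
        rw [Real.norm_eq_abs, abs_pow]
        gcongr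
        exact (abs_sub _ _).trans (add_le_add h1 h2)
      · filter_upwards [hgg'] with x hx
        simpa using (hx.sub_const (g' x)).pow 2
    have h2 := h1.sqrt
    simp only [integral_zero, Real.sqrt_zero] at h2
    refine h2.congr fun n => ?_
    rw [← MemLp.toLp_sub, ← Real.sqrt_sq (norm_nonneg _), norm_toLp_sq]
    rfl
  -- Weak times strong: replacing `g (σ n)` by `g'` costs at most `√K` times their `L²` distance.
  have hmain : Tendsto (fun n => inner ℝ ((hk (σ n)).toLp (k (σ n))) ((hG (σ n)).toLp (g (σ n))))
      atTop (𝓝 (inner ℝ f' (hG'.toLp g'))) := by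
    have h0 : Tendsto (fun n => inner ℝ ((hk (σ n)).toLp (k (σ n)))
        ((hG (σ n)).toLp (g (σ n)) - hG'.toLp g')) atTop (𝓝 0) := by
      refine squeeze_zero_norm (a := fun n => √K * ‖(hG (σ n)).toLp (g (σ n)) - hG'.toLp g'‖)
        (fun n => ?_) ?_
      · refine (norm_inner_le_norm _ _).trans ?_
        gcongr
        exact hnorm _
      · simpa using (hstrong.comp hσ.tendsto_atTop).const_mul (√K)
    have := (hweak (hG'.toLp g')).add h0
    rw [add_zero] at this
    refine this.congr fun n => ?_
    rw [← inner_add_right, add_sub_cancel]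
  simp only [inner_toLp] at hmain
  refine hmain.trans (le_of_eq ?_)
  congr 1
  rw [L2.inner_def]
  refine integral_congr_ae ?_
  filter_upwards [hG'.coeFn_toLp] with x hx
  simp [hx]

theorem integral_withDensityᵥ {α : Type*} [MeasurableSpace α] {m : Measure α} {f ψ : α → ℝ}
    (hf : Integrable f m) (hψ : Measurable ψ) {B : ℝ} (hB : ∀ x, |ψ x| ≤ B) :
    ∫ᵛ x, ψ x ∂<•(m.withDensityᵥ f) = ∫ x, ψ x * f x ∂m := by
  have hfp : IsFiniteMeasure (m.withDensity fun x => ENNReal.ofReal (f x)) :=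
    isFiniteMeasure_withDensity_ofReal hf.2
  have hfn : IsFiniteMeasure (m.withDensity fun x => ENNReal.ofReal (-f x)) :=
    isFiniteMeasure_withDensity_ofReal hf.neg.2
  have hi : ∀ ν : Measure α, [IsFiniteMeasure ν] → Integrable ψ ν := fun ν _ =>
    .of_bound hψ.aestronglyMeasurable B (.of_forall hB)
  have hprod : ∀ g : α → ℝ, Integrable g m → Integrable (fun x => g x * ψ x) m := fun g hg =>
    hg.mul_bdd hψ.aestronglyMeasurable (.of_forall hB)
  rw [withDensityᵥ_eq_withDensity_pos_part_sub_withDensity_neg_part hf,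
    VectorMeasure.integral_sub_vectorMeasure, VectorMeasure.integral_toSignedMeasure,
    VectorMeasure.integral_toSignedMeasure,
    integral_withDensity_eq_integral_toReal_smul₀ hf.aemeasurable.ennreal_ofReal (by simp),
    integral_withDensity_eq_integral_toReal_smul₀
      (f := fun x => ENNReal.ofReal (-f x)) hf.neg.aemeasurable.ennreal_ofReal (by simp)]
  · simp only [smul_eq_mul, ENNReal.toReal_ofReal']
    rw [← integral_sub (hprod _ hf.pos_part) (hprod _ hf.neg_part)]
    congr 1 with x
    rw [← sub_mul, mul_comm]
    congr 1
    rcases le_total 0 (f x) with h | h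
    · simp [h]
    · simp [h]
  · rw [VectorMeasure.Integrable, Measure.variation_toSignedMeasure]
    exact hi _
  · rw [VectorMeasure.Integrable, Measure.variation_toSignedMeasure]
    exact hi _

theorem integral_map_withDensityᵥ {α β : Type*} [MeasurableSpace α] [MeasurableSpace β]
    {m : Measure α} {f : α → ℝ} {ψ : β → ℝ} {T : α → β} (hT : Measurable T)
    (hf : Integrable f m) (hψ : Measurable ψ) {B : ℝ} (hB : ∀ x, |ψ x| ≤ B) :
    ∫ᵛ x, ψ x ∂<•((m.withDensityᵥ f).map T) = ∫ x, ψ (T x) * f x ∂m := by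
  rw [VectorMeasure.integral_map hT hψ.aestronglyMeasurable,
    integral_withDensityᵥ (ψ := fun x => ψ (T x)) hf (hψ.comp hT) fun x => hB (T x)]
  rw [VectorMeasure.Integrable, Measure.variation_withDensityᵥ hf]
  have : IsFiniteMeasure (m.withDensity fun x => ‖f x‖ₑ) := ⟨by
    rw [withDensity_apply _ .univ, Measure.restrict_univ]
    exact hf.2⟩
  exact .of_bound (hψ.comp hT).aestronglyMeasurable B (.of_forall fun x => hB (T x))

/-! ### Admissible deflections and the energy bound -/

/-- Continuous functions that agree a.e. on the open interval agree on the closed one, so the chosen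
representative does not matter. -/
theorem rightEndpointValue_eq {a c : ℝ} (hac : a < c) {u v : ℝ → ℝ} (hv : ContinuousOn v (Icc a c))
    (huv : u =ᵐ[volume.restrict (Ioo a c)] v) : rightEndpointValue a c u = v c := by
  have h : ∃ v : ℝ → ℝ, ContinuousOn v (Icc a c) ∧ u =ᵐ[volume.restrict (Ioo a c)] v := ⟨v, hv, huv⟩
  rw [rightEndpointValue, dif_pos h]
  refine Measure.eqOn_Icc_of_ae_eq volume hac.ne ?_ h.choose_spec.1 hv (right_mem_Icc.2 hac.le)
  rw [← restrict_Ioo_eq_restrict_Icc]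
  exact h.choose_spec.2.symm.trans huv

theorem MemSobolev.exists_isWeakDeriv {Ω : Set ℝ} {u : ℝ → ℝ} (hΩ : IsOpen Ω)
    (h : MemSobolev Ω 2 2 u) :
    IsWeakDeriv Ω u (weakDeriv Ω u) ∧ MemLp (weakDeriv Ω u) 2 (volume.restrict Ω) ∧
      IsWeakDeriv Ω (weakDeriv Ω u) (weakDeriv Ω (weakDeriv Ω u)) ∧
      MemLp (weakDeriv Ω (weakDeriv Ω u)) 2 (volume.restrict Ω) := by
  obtain ⟨-, g, hg, hgm, w, hw, hwm⟩ := h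
  have h1 := hg.weakDeriv_ae_eq hΩ
  have h2 : IsWeakDeriv Ω (weakDeriv Ω u) w := hw.congr h1.symm .rfl
  exact ⟨hg.isWeakDeriv_weakDeriv, (memLp_congr_ae h1).2 hgm, h2.isWeakDeriv_weakDeriv,
    (memLp_congr_ae (h2.weakDeriv_ae_eq hΩ)).2 hwm⟩

/-- The second derivative of `u`. -/
noncomputable def curvature (δ ℓ : ℝ) (u : ℝ → ℝ) : ℝ → ℝ :=
  weakDeriv (Ioo (-δ) ℓ) (weakDeriv (Ioo (-δ) ℓ) u)

/-- The representative of the derivative of `u ∈ 𝒲`. -/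
noncomputable def slope (δ ℓ : ℝ) (u : ℝ → ℝ) (x : ℝ) : ℝ := ∫ t in (-δ)..x, curvature δ ℓ u t

/-- The continuous representative of `u ∈ 𝒲`. -/
noncomputable def deflection (δ ℓ : ℝ) (u : ℝ → ℝ) (x : ℝ) : ℝ := ∫ t in (-δ)..x, slope δ ℓ u t

variable {δ ℓ : ℝ} {u : ℝ → ℝ}

theorem memLp_curvature (hu : u ∈ admissible δ ℓ) :
    MemLp (curvature δ ℓ u) 2 (volume.restrict (Ioo (-δ) ℓ)) :=
  (MemSobolev.exists_isWeakDeriv isOpen_Ioo hu.1).2.2.2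

theorem integrableOn_curvature (hu : u ∈ admissible δ ℓ) :
    IntegrableOn (curvature δ ℓ u) (Ioo (-δ) ℓ) :=
  (memLp_curvature hu).integrable (by norm_num)

theorem ae_eq_zero_Ioo_of_admissible (hu : u ∈ admissible δ ℓ) :
    u =ᵐ[volume.restrict (Ioo (-δ) 0)] 0 :=
  ae_mono (Measure.restrict_mono Ioo_subset_Ioc_self le_rfl) hu.2

theorem weakDeriv_ae_eq_zero (hℓ : 0 < ℓ) (hu : u ∈ admissible δ ℓ) :
    weakDeriv (Ioo (-δ) ℓ) u =ᵐ[volume.restrict (Ioo (-δ) 0)] 0 :=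
  ae_eq_zero_of_isWeakDeriv isOpen_Ioo
    ((MemSobolev.exists_isWeakDeriv isOpen_Ioo hu.1).1.mono (Ioo_subset_Ioo_right hℓ.le))
    (ae_eq_zero_Ioo_of_admissible hu)

theorem curvature_ae_eq_zero (hℓ : 0 < ℓ) (hu : u ∈ admissible δ ℓ) :
    curvature δ ℓ u =ᵐ[volume.restrict (Ioo (-δ) 0)] 0 :=
  ae_eq_zero_of_isWeakDeriv isOpen_Ioo
    ((MemSobolev.exists_isWeakDeriv isOpen_Ioo hu.1).2.2.1.mono (Ioo_subset_Ioo_right hℓ.le))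
    (weakDeriv_ae_eq_zero hℓ hu)

theorem weakDeriv_ae_eq_slope (hδ : 0 < δ) (hℓ : 0 < ℓ) (hu : u ∈ admissible δ ℓ) :
    weakDeriv (Ioo (-δ) ℓ) u =ᵐ[volume.restrict (Ioo (-δ) ℓ)] slope δ ℓ u :=
  (MemSobolev.exists_isWeakDeriv isOpen_Ioo hu.1).2.2.1.ae_eq_primitive (neg_lt_zero.2 hδ) hℓ.le
    (integrableOn_curvature hu) (weakDeriv_ae_eq_zero hℓ hu)

theorem isWeakDeriv_slope_curvature (hδ : 0 < δ) (hℓ : 0 < ℓ) (hu : u ∈ admissible δ ℓ) :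
    IsWeakDeriv (Ioo (-δ) ℓ) (slope δ ℓ u) (curvature δ ℓ u) :=
  isWeakDeriv_primitive (by linarith) (integrableOn_curvature hu)

theorem isWeakDeriv_slope (hδ : 0 < δ) (hℓ : 0 < ℓ) (hu : u ∈ admissible δ ℓ) :
    IsWeakDeriv (Ioo (-δ) ℓ) u (slope δ ℓ u) :=
  (MemSobolev.exists_isWeakDeriv isOpen_Ioo hu.1).1.congr .rfl (weakDeriv_ae_eq_slope hδ hℓ hu)

theorem continuousOn_slope (hδ : 0 < δ) (hℓ : 0 < ℓ) (hu : u ∈ admissible δ ℓ) :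
    ContinuousOn (slope δ ℓ u) (Icc (-δ) ℓ) :=
  continuousOn_primitive_Ioo (by linarith) (integrableOn_curvature hu)

theorem integrableOn_slope (hδ : 0 < δ) (hℓ : 0 < ℓ) (hu : u ∈ admissible δ ℓ) :
    IntegrableOn (slope δ ℓ u) (Ioo (-δ) ℓ) :=
  (continuousOn_slope hδ hℓ hu).integrableOn_Icc.mono_set Ioo_subset_Icc_self

theorem ae_eq_deflection (hδ : 0 < δ) (hℓ : 0 < ℓ) (hu : u ∈ admissible δ ℓ) :
    u =ᵐ[volume.restrict (Ioo (-δ) ℓ)] deflection δ ℓ u :=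
  (isWeakDeriv_slope hδ hℓ hu).ae_eq_primitive (neg_lt_zero.2 hδ) hℓ.le
    (integrableOn_slope hδ hℓ hu) (ae_eq_zero_Ioo_of_admissible hu)

theorem rightEndpointValue_eq_deflection (hδ : 0 < δ) (hℓ : 0 < ℓ) (hu : u ∈ admissible δ ℓ) :
    rightEndpointValue (-δ) ℓ u = deflection δ ℓ u ℓ :=
  rightEndpointValue_eq (by linarith)
    (continuousOn_primitive_Ioo (by linarith) (integrableOn_slope hδ hℓ hu))
    (ae_eq_deflection hδ hℓ hu)

theorem memSobolev_one_one (hδ : 0 < δ) (hℓ : 0 < ℓ) (hu : u ∈ admissible δ ℓ) :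
    MemSobolev (Ioo (-δ) ℓ) 1 1 u :=
  ⟨MemLp.mono_exponent hu.1.1 (by norm_num), slope δ ℓ u, isWeakDeriv_slope hδ hℓ hu,
    memLp_one_iff_integrable.2 (integrableOn_slope hδ hℓ hu)⟩

theorem abs_slope_le (hu : u ∈ admissible δ ℓ) {x : ℝ} (hx : x ∈ Ioo (-δ) ℓ) :
    |slope δ ℓ u x| ≤ ∫ t in Ioo (-δ) ℓ, |curvature δ ℓ u t| := by
  rw [slope, intervalIntegral.integral_of_le hx.1.le]
  refine abs_integral_le_integral_abs.trans ?_
  exact setIntegral_mono_set (integrableOn_curvature hu).abs (.of_forall fun _ => abs_nonneg _)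
    (LE.le.eventuallyLE fun t ht => ⟨ht.1, ht.2.trans_lt hx.2⟩)

/-- Puts the slope at a point in the form of a pairing of the curvature with a bounded function, to
which the weak limit applies. -/
theorem slope_eq_setIntegral {x : ℝ} (hx : x ∈ Ioo (-δ) ℓ) :
    slope δ ℓ u x = ∫ t in Ioo (-δ) ℓ, (Iic x).indicator 1 t * curvature δ ℓ u t := by
  have h : (fun t => (Iic x).indicator 1 t * curvature δ ℓ u t) =
      (Iic x).indicator (curvature δ ℓ u) := by
    ext t
    by_cases ht : t ∈ Iic x <;> simp [ht]
  rw [h, setIntegral_indicator measurableSet_Iic, slope, intervalIntegral.integral_of_le hx.1.le]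
  congr 2
  ext t
  exact ⟨fun ht => ⟨⟨ht.1, ht.2.trans_lt hx.2⟩, ht.2⟩, fun ht => ⟨ht.1.1, ht.2⟩⟩

theorem abs_deflection_le (hδ : 0 < δ) (hℓ : 0 < ℓ) (hu : u ∈ admissible δ ℓ) :
    |deflection δ ℓ u ℓ| ≤ (∫ t in Ioo (-δ) ℓ, |curvature δ ℓ u t|) * (ℓ + δ) := by
  rw [deflection, intervalIntegral.integral_of_le (by linarith), integral_Ioc_eq_integral_Ioo]
  refine (norm_setIntegral_le_of_norm_le_const (f := slope δ ℓ u)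
    (C := ∫ t in Ioo (-δ) ℓ, |curvature δ ℓ u t|) measure_Ioo_lt_top
    fun x hx => abs_slope_le hu hx).trans ?_
  rw [Measure.real, Real.volume_Ioo, ENNReal.toReal_ofReal (by linarith), sub_neg_eq_add]

/-- Since the load term is a finite real, the bending integral is finite, and infinite stiffness off
`C_n` is compatible with that only if the curvature vanishes there a.e. -/
theorem energy_bound (hδ : 0 < δ) (hℓ : 0 < ℓ) {b P M : ℝ} (hb : 0 < b) {n : ℕ}
    (hu : u ∈ admissible δ ℓ) (hE : energy δ ℓ b P n u ≤ M) :
    (∀ᵐ x ∂volume.restrict (Ioo (-δ) ℓ), x ∉ cantorStep ℓ n → curvature δ ℓ u x = 0) ∧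
      (2 / 3) ^ n * b * ∫ x in Ioo (-δ) ℓ, curvature δ ℓ u x ^ 2 ≤
        2 * (M + P * deflection δ ℓ u ℓ) := by
  rw [energy, if_pos hu, rightEndpointValue_eq_deflection hδ hℓ hu] at hE
  change (((2⁻¹ * ∫⁻ x in Ioo 0 ℓ, stiffness ℓ b n x * ‖curvature δ ℓ u x‖ₑ ^ 2 : ℝ≥0∞) : EReal) -
    ((P * deflection δ ℓ u ℓ : ℝ) : EReal)) ≤ M at hE
  have hsub : Ioo 0 ℓ ⊆ Ioo (-δ) ℓ := Ioo_subset_Ioo_left (by linarith)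
  have hmem : MemLp (curvature δ ℓ u) 2 (volume.restrict (Ioo 0 ℓ)) :=
    (memLp_curvature hu).mono_measure (Measure.restrict_mono hsub le_rfl)
  set I := ∫⁻ x in Ioo 0 ℓ, stiffness ℓ b n x * ‖curvature δ ℓ u x‖ₑ ^ 2 with hI
  have hE' : ((2⁻¹ * I : ℝ≥0∞) : EReal) ≤ ((M + P * deflection δ ℓ u ℓ : ℝ) : EReal) := by
    rw [EReal.sub_le_iff_le_add (by simp) (by simp)] at hE
    rwa [EReal.coe_add]
  have hfin : I ≠ ⊤ := by
    intro h
    rw [h, ENNReal.mul_top (by simp)] at hE'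
    exact EReal.coe_ne_top _ (top_le_iff.1 hE')
  have hst : Measurable (stiffness ℓ b n) :=
    Measurable.ite (measurableSet_cantorStep ℓ n) measurable_const measurable_const
  have hae := ae_lt_top' (hst.aemeasurable.mul (hmem.aestronglyMeasurable.enorm.pow_const 2)) hfin
  have hoff : ∀ᵐ x ∂volume.restrict (Ioo 0 ℓ), x ∉ cantorStep ℓ n → curvature δ ℓ u x = 0 := by
    filter_upwards [hae] with x hx hxn
    by_contra h0
    rw [Pi.mul_apply, stiffness, if_neg hxn, ENNReal.top_mul (by simpa using h0)] at hx
    exact lt_irrefl _ hx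
  have hpow : 0 < (2 / 3 : ℝ) ^ n * b := by positivity
  have hIeq : I = ENNReal.ofReal ((2 / 3) ^ n * b * ∫ x in Ioo 0 ℓ, curvature δ ℓ u x ^ 2) := by
    rw [← integral_const_mul, ofReal_integral_eq_lintegral_ofReal (hmem.integrable_sq.const_mul _)
      (.of_forall fun x => by positivity), hI]
    refine lintegral_congr_ae ?_
    filter_upwards [hoff] with x hx
    by_cases hxn : x ∈ cantorStep ℓ n
    · simp only [stiffness, if_pos hxn]
      rw [ENNReal.ofReal_mul hpow.le, ← sq_abs, ENNReal.ofReal_pow (abs_nonneg _),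
        Real.enorm_eq_ofReal_abs]
    · simp [hx hxn]
  have hz : ∀ᵐ x ∂volume.restrict (Ioo (-δ) ℓ), x ∉ Ioo 0 ℓ → curvature δ ℓ u x = 0 := by
    rw [ae_restrict_iff' measurableSet_Ioo]
    filter_upwards [(ae_restrict_iff' measurableSet_Ioo).1 (curvature_ae_eq_zero hℓ hu),
      Measure.ae_ne volume 0] with x hx hx0 hxm hxn
    exact hx ⟨hxm.1, lt_of_not_ge fun h => hxn ⟨lt_of_le_of_ne h hx0.symm, hxm.2⟩⟩
  constructor
  · rw [ae_restrict_iff' measurableSet_Ioo] at hz hoff ⊢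
    filter_upwards [hz, hoff] with x h1 h2 hxm hxn
    by_cases h : x ∈ Ioo 0 ℓ
    · exact h2 h hxn
    · exact h1 hxm h
  · have hint : ∫ x in Ioo (-δ) ℓ, curvature δ ℓ u x ^ 2 =
        ∫ x in Ioo 0 ℓ, curvature δ ℓ u x ^ 2 := by
      refine setIntegral_eq_of_subset_of_ae_sdiff_eq_zero measurableSet_Ioo.nullMeasurableSet hsub ?_
      filter_upwards [(ae_restrict_iff' measurableSet_Ioo).1 hz] with x hx hxd
      rw [hx hxd.1 hxd.2]
      norm_num
    rw [hint]
    have hnn : 0 ≤ ∫ x in Ioo 0 ℓ, curvature δ ℓ u x ^ 2 := integral_nonneg fun x => by positivity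
    have h2 : (2⁻¹ * I : ℝ≥0∞) =
        ENNReal.ofReal (2⁻¹ * ((2 / 3) ^ n * b * ∫ x in Ioo 0 ℓ, curvature δ ℓ u x ^ 2)) := by
      rw [ENNReal.ofReal_mul (by norm_num), ← hIeq, ENNReal.ofReal_inv_of_pos (by norm_num)]
      simp
    rw [h2, EReal.coe_ennreal_ofReal, max_eq_left (by positivity), EReal.coe_le_coe_iff] at hE'
    linarith

/-! ### Transfer to the parameter interval -/

theorem cantorStep_inter_ae_eq (hδ : 0 < δ) (hℓ : 0 < ℓ) (n : ℕ) :
    (Ioo (-δ) ℓ ∩ cantorStep ℓ n : Set ℝ) =ᵐ[volume] cantorStep ℓ n := by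
  rw [eventuallyEq_set]
  filter_upwards [Measure.ae_ne volume ℓ] with x hx
  refine ⟨fun h => h.2, fun h => ⟨?_, h⟩⟩
  have := cantorStep_subset_Icc hℓ n h
  exact ⟨by linarith [this.1], lt_of_le_of_ne this.2 hx⟩

theorem restrict_cantorStep_le (hδ : 0 < δ) (hℓ : 0 < ℓ) (n : ℕ) :
    (volume : Measure ℝ).restrict (cantorStep ℓ n) ≤ volume.restrict (Ioo (-δ) ℓ) := by
  rw [← Measure.restrict_congr_set (cantorStep_inter_ae_eq hδ hℓ n)]
  exact Measure.restrict_mono inter_subset_left le_rfl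

/-- Change of variables by `map_cantorParam`: `(2/3)^n` cancels the density `(3/2)^n` of the image
measure. -/
theorem setIntegral_eq_integral_cantorParam (hδ : 0 < δ) (hℓ : 0 < ℓ) {n : ℕ} {h : ℝ → ℝ}
    (hm : AEStronglyMeasurable h (volume.restrict (Ioo (-δ) ℓ)))
    (h0 : ∀ᵐ x ∂volume.restrict (Ioo (-δ) ℓ), x ∉ cantorStep ℓ n → h x = 0) :
    ∫ x in Ioo (-δ) ℓ, h x = ∫ y in Ico 0 ℓ, (2 / 3) ^ n * h (cantorParam ℓ n y) := by
  have h1 : ∫ x in Ioo (-δ) ℓ, h x = ∫ x in cantorStep ℓ n, h x := by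
    rw [← Measure.restrict_congr_set (cantorStep_inter_ae_eq hδ hℓ n),
      ← setIntegral_indicator (measurableSet_cantorStep ℓ n)]
    refine integral_congr_ae ?_
    filter_upwards [h0] with x hx
    by_cases hxn : x ∈ cantorStep ℓ n <;> simp [hxn, hx]
  have h2 := integral_map (μ := volume.restrict (Ico 0 ℓ)) (f := h)
    (measurable_cantorParam ℓ n).aemeasurable (by
      rw [map_cantorParam hℓ n]
      exact (hm.mono_measure (restrict_cantorStep_le hδ hℓ n)).smul_measure _)
  rw [integral_const_mul, ← h2, map_cantorParam hℓ n, integral_smul_measure,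
    ENNReal.toReal_ofReal (by positivity), smul_eq_mul, ← mul_assoc, ← mul_pow, h1]
  norm_num

/-- The second derivative of `u`, rescaled and transported to the parameter interval. -/
noncomputable def scaledCurvature (δ ℓ : ℝ) (n : ℕ) (u : ℝ → ℝ) (y : ℝ) : ℝ :=
  (2 / 3) ^ n * curvature δ ℓ u (cantorParam ℓ n y)

theorem memLp_scaledCurvature (hδ : 0 < δ) (hℓ : 0 < ℓ) (n : ℕ) (hu : u ∈ admissible δ ℓ) :
    MemLp (scaledCurvature δ ℓ n u) 2 (volume.restrict (Ico 0 ℓ)) := by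
  refine MemLp.const_mul ?_ _
  refine MemLp.comp_of_map ?_ (measurable_cantorParam ℓ n).aemeasurable
  rw [map_cantorParam hℓ n]
  exact ((memLp_curvature hu).mono_measure (restrict_cantorStep_le hδ hℓ n)).smul_measure
    ENNReal.ofReal_ne_top

theorem setIntegral_mul_curvature (hδ : 0 < δ) (hℓ : 0 < ℓ) {n : ℕ} (hu : u ∈ admissible δ ℓ)
    (h0 : ∀ᵐ x ∂volume.restrict (Ioo (-δ) ℓ), x ∉ cantorStep ℓ n → curvature δ ℓ u x = 0)
    {ψ : ℝ → ℝ} (hψ : Measurable ψ) :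
    ∫ x in Ioo (-δ) ℓ, ψ x * curvature δ ℓ u x =
      ∫ y in Ico 0 ℓ, ψ (cantorParam ℓ n y) * scaledCurvature δ ℓ n u y := by
  rw [setIntegral_eq_integral_cantorParam hδ hℓ (n := n)]
  · congr 1 with y
    rw [scaledCurvature]
    ring
  · exact hψ.aestronglyMeasurable.mul (memLp_curvature hu).aestronglyMeasurable
  · filter_upwards [h0] with x hx hxn
    rw [hx hxn, mul_zero]

theorem setIntegral_abs_curvature (hδ : 0 < δ) (hℓ : 0 < ℓ) {n : ℕ} (hu : u ∈ admissible δ ℓ)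
    (h0 : ∀ᵐ x ∂volume.restrict (Ioo (-δ) ℓ), x ∉ cantorStep ℓ n → curvature δ ℓ u x = 0) :
    ∫ x in Ioo (-δ) ℓ, |curvature δ ℓ u x| = ∫ y in Ico 0 ℓ, |scaledCurvature δ ℓ n u y| := by
  rw [setIntegral_eq_integral_cantorParam hδ hℓ (n := n)]
  · congr 1 with y
    rw [scaledCurvature, abs_mul, abs_of_pos (by positivity : (0 : ℝ) < (2 / 3) ^ n)]
  · exact (integrableOn_curvature hu).abs.aestronglyMeasurable
  · filter_upwards [h0] with x hx hxn
    rw [hx hxn, abs_zero]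

/-- Of the two factors `(2/3)^n` in the square, one is the change of variables; the other matches
the stiffness `(2/3)^n b`, which makes the energy bound uniform in `n`. -/
theorem integral_sq_scaledCurvature (hδ : 0 < δ) (hℓ : 0 < ℓ) {n : ℕ} (hu : u ∈ admissible δ ℓ)
    (h0 : ∀ᵐ x ∂volume.restrict (Ioo (-δ) ℓ), x ∉ cantorStep ℓ n → curvature δ ℓ u x = 0) :
    ∫ y in Ico 0 ℓ, scaledCurvature δ ℓ n u y ^ 2 =
      (2 / 3) ^ n * ∫ x in Ioo (-δ) ℓ, curvature δ ℓ u x ^ 2 := by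
  rw [setIntegral_eq_integral_cantorParam hδ hℓ (n := n), ← integral_const_mul]
  · congr 1 with y
    rw [scaledCurvature]
    ring
  · exact (memLp_curvature hu).integrable_sq.aestronglyMeasurable
  · filter_upwards [h0] with x hx hxn
    rw [hx hxn]
    norm_num

/-- Integrate `(2θ|k| - 1)² ≥ 0`; `θ` stays free so that the load can be absorbed. -/
theorem integral_abs_le_of_sq {k : ℝ → ℝ} (hℓ : 0 < ℓ)
    (hk : MemLp k 2 (volume.restrict (Ico 0 ℓ))) {θ : ℝ} (hθ : 0 < θ) :
    ∫ y in Ico 0 ℓ, |k y| ≤ θ * (∫ y in Ico 0 ℓ, k y ^ 2) + ℓ / (4 * θ) := by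
  have h1 : ∫ y in Ico 0 ℓ, (θ * k y ^ 2 + 1 / (4 * θ)) =
      θ * (∫ y in Ico 0 ℓ, k y ^ 2) + ℓ / (4 * θ) := by
    rw [integral_add (hk.integrable_sq.const_mul _) (integrable_const _), integral_const_mul,
      integral_const, smul_eq_mul]
    congr 1
    rw [Measure.real, Measure.restrict_apply_univ, Real.volume_Ico,
      ENNReal.toReal_ofReal (by linarith)]
    ring
  rw [← h1]
  refine integral_mono (hk.integrable (by norm_num)).abs
    ((hk.integrable_sq.const_mul _).add (integrable_const _)) fun y => ?_
  have h2 : 0 ≤ (2 * θ * |k y| - 1) ^ 2 / (4 * θ) := by positivity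
  have h3 : (2 * θ * |k y| - 1) ^ 2 / (4 * θ) = θ * k y ^ 2 + 1 / (4 * θ) - |k y| := by
    rw [← sq_abs (k y)]
    field_simp
    ring
  simp only
  linarith

theorem exists_bound_scaledCurvature (hδ : 0 < δ) (hℓ : 0 < ℓ) {b P : ℝ} (hb : 0 < b) (hP : 0 < P)
    (M : ℝ) : ∃ K, ∀ (n : ℕ) (u : ℝ → ℝ), u ∈ admissible δ ℓ → energy δ ℓ b P n u ≤ M →
      ∫ y in Ico 0 ℓ, scaledCurvature δ ℓ n u y ^ 2 ≤ K ∧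
      ∫ y in Ico 0 ℓ, |scaledCurvature δ ℓ n u y| ≤ K := by
  -- Chosen so that `2P(ℓ + δ)θ = b/2`: the load then uses up only half of the quadratic term, and
  -- `K₁` results from solving for the other half.
  set θ := b / (4 * P * (ℓ + δ)) with hθ
  have hθpos : 0 < θ := by positivity
  set K₁ := 2 / b * (2 * M + 2 * P * (ℓ + δ) * (ℓ / (4 * θ))) with hK₁
  refine ⟨max K₁ (θ * K₁ + ℓ / (4 * θ)), fun n u hu hE => ?_⟩
  obtain ⟨h0, hen⟩ := energy_bound hδ hℓ hb hu hE
  have h1 := integral_abs_le_of_sq hℓ (memLp_scaledCurvature hδ hℓ n hu) hθpos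
  have h2 := abs_deflection_le hδ hℓ hu
  rw [setIntegral_abs_curvature hδ hℓ hu h0] at h2
  have h3 := integral_sq_scaledCurvature hδ hℓ hu h0
  set A := ∫ y in Ico 0 ℓ, scaledCurvature δ ℓ n u y ^ 2
  set L := ∫ y in Ico 0 ℓ, |scaledCurvature δ ℓ n u y|
  have h4 : b * A ≤ 2 * (M + P * deflection δ ℓ u ℓ) := by
    rw [h3]
    linarith
  have h5 : P * deflection δ ℓ u ℓ ≤ P * ((θ * A + ℓ / (4 * θ)) * (ℓ + δ)) := by
    gcongr
    exact (le_abs_self _).trans (h2.trans (by gcongr))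
  have h6 : 2 * (P * (θ * A * (ℓ + δ))) = b / 2 * A := by
    rw [hθ]
    field_simp
    ring
  have h7 : A ≤ K₁ := by
    have h8 : b / 2 * A ≤ 2 * M + 2 * P * (ℓ + δ) * (ℓ / (4 * θ)) := by nlinarith
    rw [hK₁, div_mul_eq_mul_div, le_div_iff₀ hb]
    linarith
  exact ⟨h7.trans (le_max_left _ _), (h1.trans (by gcongr)).trans (le_max_right _ _)⟩

/-! ### The limit measure and the limit deflection -/

/-- Only the endpoint `ℓ` could be hit outside the open interval, and single points have null
preimage. -/
theorem ae_cantorMap_mem_Ioo {δ ℓ : ℝ} (hδ : 0 < δ) (hℓ : 0 < ℓ) :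
    ∀ᵐ y ∂volume.restrict (Ico 0 ℓ), cantorMap ℓ y ∈ Ioo (-δ) ℓ := by
  have h := volume_cantorMap_preimage_subsingleton hℓ (A := {ℓ}) subsingleton_singleton
  rw [ae_restrict_iff' measurableSet_Ico]
  filter_upwards [measure_eq_zero_iff_ae_notMem.1 h] with y hy hy'
  have h1 := cantorMap_mem_Icc hℓ hy'
  exact ⟨by linarith [h1.1], lt_of_le_of_ne h1.2 fun h => hy ⟨hy', h⟩⟩

theorem ae_cantorMap_ne {ℓ : ℝ} (hℓ : 0 < ℓ) (x : ℝ) :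
    ∀ᵐ y ∂volume.restrict (Ico 0 ℓ), cantorMap ℓ y ≠ x := by
  have h := volume_cantorMap_preimage_subsingleton hℓ (A := {x}) subsingleton_singleton
  rw [ae_restrict_iff' measurableSet_Ico]
  filter_upwards [measure_eq_zero_iff_ae_notMem.1 h] with y hy hy'
  exact fun h => hy ⟨hy', h⟩

open Classical in
/-- The map `cantorMap ℓ` with values in `(-δ, ℓ)`, up to a null set. -/
noncomputable def cantorMapIoo {δ ℓ : ℝ} (hδ : 0 < δ) (hℓ : 0 < ℓ) (y : ℝ) : Ioo (-δ) ℓ :=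
  ⟨if cantorMap ℓ y ∈ Ioo (-δ) ℓ then cantorMap ℓ y else 0, by
    split_ifs with h
    · exact h
    · exact ⟨neg_lt_zero.2 hδ, hℓ⟩⟩

theorem coe_cantorMapIoo {δ ℓ : ℝ} (hδ : 0 < δ) (hℓ : 0 < ℓ) {y : ℝ}
    (hy : cantorMap ℓ y ∈ Ioo (-δ) ℓ) : (cantorMapIoo hδ hℓ y : ℝ) = cantorMap ℓ y :=
  if_pos hy

theorem measurable_cantorMapIoo {δ ℓ : ℝ} (hδ : 0 < δ) (hℓ : 0 < ℓ) :
    Measurable (cantorMapIoo hδ hℓ) :=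
  (Measurable.ite (measurable_cantorMap hℓ measurableSet_Ioo) (measurable_cantorMap hℓ)
    measurable_const).subtype_mk

/-- An `η`-null set has a Lebesgue-null preimage under `cantorMap`, and `k 𝓛` vanishes on null sets.
-/
theorem cantor_map_withDensityᵥ_absolutelyContinuous {δ ℓ : ℝ} (hδ : 0 < δ) (hℓ : 0 < ℓ)
    (k : ℝ → ℝ) :
    VectorMeasure.AbsolutelyContinuous
      (((volume.restrict (Ico 0 ℓ)).withDensityᵥ k).map (cantorMapIoo hδ hℓ))
      ((cantorMeasure ℓ).comap ((↑) : Ioo (-δ) ℓ → ℝ)).toENNRealVectorMeasure := by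
  refine VectorMeasure.AbsolutelyContinuous.mk fun A hA h0 => ?_
  have hemb : MeasurableEmbedding ((↑) : Ioo (-δ) ℓ → ℝ) := .subtype_coe measurableSet_Ioo
  rw [Measure.toENNRealVectorMeasure_apply_measurable hA, hemb.comap_apply] at h0
  have h1 := volume_cantorMap_preimage_eq_zero hℓ (hemb.measurableSet_image.2 hA) h0
  rw [VectorMeasure.map_apply _ (measurable_cantorMapIoo hδ hℓ) hA]
  refine Measure.withDensityᵥ_absolutelyContinuous _ k ?_
  have hA' := measurable_cantorMapIoo hδ hℓ hA
  rw [Measure.toENNRealVectorMeasure_apply_measurable hA', measure_eq_zero_iff_ae_notMem]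
  filter_upwards [ae_cantorMap_mem_Ioo hδ hℓ, ae_restrict_mem measurableSet_Ico,
    ae_restrict_of_ae (measure_eq_zero_iff_ae_notMem.1 h1)] with y h2 h3 h4 h5
  exact h4 ⟨h3, cantorMapIoo hδ hℓ y, h5, coe_cantorMapIoo hδ hℓ h2⟩

theorem integral_densityMeasure {Ω : Set ℝ} (hΩ : MeasurableSet Ω) {f : ℝ → ℝ}
    (hf : IntegrableOn f Ω) {ψ : Ω → ℝ} (hψ : Measurable ψ) {B : ℝ} (hB : ∀ x, |ψ x| ≤ B) :
    ∫ᵛ x, ψ x ∂<•(densityMeasure Ω f) =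
      ∫ x in Ω, Function.extend ((↑) : Ω → ℝ) ψ 0 x * f x := by
  rw [densityMeasure, integral_withDensityᵥ _ hψ hB, ← integral_subtype_comap hΩ]
  · congr 1 with x
    rw [Subtype.val_injective.extend_apply]
  · exact (integrableOn_iff_comap_subtypeVal hΩ).1 hf

theorem eLpNorm_one_eq_ofReal_integral {α : Type*} [MeasurableSpace α] {m : Measure α} {f : α → ℝ}
    (hf : Integrable f m) : eLpNorm f 1 m = ENNReal.ofReal (∫ x, |f x| ∂m) := by
  rw [eLpNorm_one_eq_lintegral_enorm, ← ofReal_integral_norm_eq_lintegral_enorm hf]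
  rfl

theorem tendstoSobolev_one_one {Ω : Set ℝ} (hΩ : IsOpen Ω) {u g : ℕ → ℝ → ℝ} {v f : ℝ → ℝ}
    (hu : ∀ n, IsWeakDeriv Ω (u n) (g n)) (hv : IsWeakDeriv Ω v f)
    (hui : ∀ n, IntegrableOn (u n) Ω) (hgi : ∀ n, IntegrableOn (g n) Ω) (hvi : IntegrableOn v Ω)
    (hfi : IntegrableOn f Ω)
    (h₀ : Tendsto (fun n => ∫ x in Ω, |u n x - v x|) atTop (𝓝 0))
    (h₁ : Tendsto (fun n => ∫ x in Ω, |g n x - f x|) atTop (𝓝 0)) :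
    TendstoSobolev Ω 1 1 u v := by
  refine ⟨fun n => ⟨memLp_one_iff_integrable.2 (hui n), g n, hu n,
    memLp_one_iff_integrable.2 (hgi n)⟩, ⟨memLp_one_iff_integrable.2 hvi, f, hv,
    memLp_one_iff_integrable.2 hfi⟩, ?_⟩
  have h : ∀ n, sobolevNorm Ω 1 1 (fun x => u n x - v x) =
      ENNReal.ofReal (∫ x in Ω, |u n x - v x|) + ENNReal.ofReal (∫ x in Ω, |g n x - f x|) := by
    intro n
    rw [sobolevNorm, Finset.sum_range_succ, Finset.sum_range_one, Function.iterate_zero, id,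
      Function.iterate_one, eLpNorm_congr_ae (((hu n).sub hv).weakDeriv_ae_eq hΩ),
      eLpNorm_one_eq_ofReal_integral (f := fun x => u n x - v x) ((hui n).sub hvi),
      eLpNorm_one_eq_ofReal_integral (f := fun x => g n x - f x) ((hgi n).sub hfi)]
  simp_rw [h]
  simpa using (ENNReal.tendsto_ofReal h₀).add (ENNReal.tendsto_ofReal h₁)

theorem tendsto_integral_primitive_sub {a c : ℝ} (hac : a ≤ c) {g : ℕ → ℝ → ℝ} {f : ℝ → ℝ}
    (hg : ∀ n, IntegrableOn (g n) (Ioo a c)) (hf : IntegrableOn f (Ioo a c))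
    (h : Tendsto (fun n => ∫ x in Ioo a c, |g n x - f x|) atTop (𝓝 0)) :
    Tendsto (fun n => ∫ x in Ioo a c, |(∫ t in a..x, g n t) - ∫ t in a..x, f t|) atTop (𝓝 0) := by
  refine squeeze_zero (fun n => integral_nonneg fun _ => abs_nonneg _) (fun n => ?_)
    (by simpa using h.mul_const (c - a))
  have hi : ∀ {k : ℝ → ℝ} {x : ℝ}, IntegrableOn k (Ioo a c) → x ∈ Ioo a c →
      IntervalIntegrable k volume a x := fun {k x} hk hx =>
    (intervalIntegrable_iff_integrableOn_Ioo_of_le hx.1.le).2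
      (hk.mono_set (Ioo_subset_Ioo_right hx.2.le))
  have hb : ∀ x ∈ Ioo a c, |(∫ t in a..x, g n t) - ∫ t in a..x, f t| ≤
      ∫ t in Ioo a c, |g n t - f t| := by
    intro x hx
    rw [← intervalIntegral.integral_sub (hi (hg n) hx) (hi hf hx),
      intervalIntegral.integral_of_le hx.1.le]
    refine abs_integral_le_integral_abs.trans ?_
    exact setIntegral_mono_set ((hg n).sub hf).abs (.of_forall fun _ => abs_nonneg _)
      (LE.le.eventuallyLE fun t ht => ⟨ht.1, ht.2.trans_lt hx.2⟩)
  have h1 := norm_setIntegral_le_of_norm_le_const (μ := volume) (s := Ioo a c)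
    (f := fun x => |(∫ t in a..x, g n t) - ∫ t in a..x, f t|) measure_Ioo_lt_top
    (fun x hx => (abs_abs _).trans_le (hb x hx))
  rw [Measure.real, Real.volume_Ioo, ENNReal.toReal_ofReal (by linarith)] at h1
  exact (le_abs_self _).trans h1

/-- The derivative of the limit deflection. -/
noncomputable def limitSlope (ℓ : ℝ) (k : ℝ → ℝ) (x : ℝ) : ℝ :=
  ∫ y in Ico 0 ℓ, (Iic x).indicator 1 (cantorMap ℓ y) * k y

end CantorBeam

open CantorBeam

/-! ### The compactness theorem -/

theorem mainTheorem2 (δ ℓ b P : ℝ) (hδ : 0 < δ) (hℓ : 0 < ℓ) (hb : 0 < b) (hP : 0 < P)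
    (u : ℕ → ℝ → ℝ) (hu : ∀ n, u n ∈ admissible δ ℓ)
    (hE : (⨆ n, energy δ ℓ b P n (u n)) < ⊤) :
    ∃ σ : ℕ → ℕ, StrictMono σ ∧
      ∃ v : ℝ → ℝ, MemSobolev (Ioo (-δ) ℓ) 1 1 v ∧
        MemBV (Ioo (-δ) ℓ) (weakDeriv (Ioo (-δ) ℓ) v) ∧
        TendstoSobolev (Ioo (-δ) ℓ) 1 1 (fun k => u (σ k)) v ∧
        ∃ μ : SignedMeasure (Ioo (-δ) ℓ),
          IsMeasureDeriv (Ioo (-δ) ℓ) (weakDeriv (Ioo (-δ) ℓ) v) μ ∧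
          TendstoWeakStar (fun k => densityMeasure (Ioo (-δ) ℓ)
            (weakDeriv (Ioo (-δ) ℓ) (weakDeriv (Ioo (-δ) ℓ) (u (σ k))))) μ ∧
          VectorMeasure.AbsolutelyContinuous μ
            ((cantorMeasure ℓ).comap ((↑) : Ioo (-δ) ℓ → ℝ)).toENNRealVectorMeasure := by
  have hΩ : IsOpen (Ioo (-δ) ℓ) := isOpen_Ioo
  have hle : -δ ≤ ℓ := by linarith
  obtain ⟨M, hM, -⟩ := EReal.lt_iff_exists_real_btwn.1 hE
  have hEn : ∀ n, energy δ ℓ b P n (u n) ≤ M := fun n =>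
    (le_iSup (fun n => energy δ ℓ b P n (u n)) n).trans hM.le
  obtain ⟨K, hK⟩ := exists_bound_scaledCurvature hδ hℓ hb hP M
  have h0 := fun n => (energy_bound hδ hℓ hb (hu n) (hEn n)).1
  obtain ⟨σ, hσ, k, hk, hlim⟩ := exists_subseq_tendsto_integral_mul
    (fun n => memLp_scaledCurvature hδ hℓ n (hu n)) (fun n => (hK n _ (hu n) (hEn n)).1)
  have hki : Integrable k (volume.restrict (Ico 0 ℓ)) := hk.integrable (by norm_num)
  -- integrals against the second derivatives pass to the limit
  have hpass : ∀ (ψ : ℝ → ℝ) (B : ℝ), Measurable ψ → (∀ x, |ψ x| ≤ B) →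
      (∀ᵐ y ∂volume.restrict (Ico 0 ℓ), ContinuousAt ψ (cantorMap ℓ y)) →
      Tendsto (fun n => ∫ x in Ioo (-δ) ℓ, ψ x * curvature δ ℓ (u (σ n)) x) atTop
        (𝓝 (∫ y in Ico 0 ℓ, ψ (cantorMap ℓ y) * k y)) := by
    intro ψ B hψ hB hc
    simp_rw [fun n => setIntegral_mul_curvature hδ hℓ (hu (σ n)) (h0 (σ n)) hψ]
    refine hlim (fun n y => ψ (cantorParam ℓ n y)) _ B
      (fun n => (hψ.comp (measurable_cantorParam ℓ n)).aestronglyMeasurable)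
      (fun n => .of_forall fun y => hB _) ?_
    filter_upwards [hc, ae_restrict_mem measurableSet_Ico] with y hy hy'
    exact hy.tendsto.comp (tendsto_cantorParam hℓ hy')
  set F := limitSlope ℓ k with hF
  -- The indicator of `(-∞, x]` jumps only at `x`, which `cantorMap ℓ` avoids for a.e. `y`; this is
  -- why `hpass` asks for continuity only almost everywhere along `cantorMap ℓ`.
  have hGF : ∀ x ∈ Ioo (-δ) ℓ, Tendsto (fun n => slope δ ℓ (u (σ n)) x) atTop (𝓝 (F x)) := by
    intro x hx
    simp_rw [fun n => slope_eq_setIntegral (u := u (σ n)) hx]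
    refine hpass ((Iic x).indicator 1) 1 (measurable_one.indicator measurableSet_Iic)
      (fun t => ?_) ?_
    · by_cases ht : t ∈ Iic x <;> simp [ht]
    · filter_upwards [ae_cantorMap_ne hℓ x] with y hy
      refine ContinuousOn.continuousAt_indicator (f := 1) continuous_one.continuousOn ?_
      simpa using hy
  have hGK : ∀ n, ∀ x ∈ Ioo (-δ) ℓ, |slope δ ℓ (u (σ n)) x| ≤ K := fun n x hx => by
    refine (abs_slope_le (hu _) hx).trans ?_
    rw [setIntegral_abs_curvature hδ hℓ (hu _) (h0 _)]
    exact (hK _ _ (hu _) (hEn _)).2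
  have hFK : ∀ x ∈ Ioo (-δ) ℓ, |F x| ≤ K := fun x hx =>
    le_of_tendsto' (hGF x hx).abs fun n => hGK n x hx
  have hGi : ∀ n, IntegrableOn (slope δ ℓ (u (σ n))) (Ioo (-δ) ℓ) := fun n =>
    integrableOn_slope hδ hℓ (hu _)
  have hFm : AEStronglyMeasurable F (volume.restrict (Ioo (-δ) ℓ)) := by
    refine aestronglyMeasurable_of_tendsto_ae atTop (fun n => (hGi n).aestronglyMeasurable) ?_
    filter_upwards [ae_restrict_mem measurableSet_Ioo] with x hx using hGF x hx
  have hFi : IntegrableOn F (Ioo (-δ) ℓ) := by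
    refine Integrable.of_bound hFm K ?_
    filter_upwards [ae_restrict_mem measurableSet_Ioo] with x hx using hFK x hx
  have hL1 : Tendsto (fun n => ∫ x in Ioo (-δ) ℓ, |slope δ ℓ (u (σ n)) x - F x|) atTop (𝓝 0) := by
    have : Tendsto (fun n => ∫ x in Ioo (-δ) ℓ, |slope δ ℓ (u (σ n)) x - F x|) atTop
        (𝓝 (∫ _ in Ioo (-δ) ℓ, (0 : ℝ))) := by
      refine tendsto_integral_of_dominated_convergence (fun _ => K + K)
        (fun n => ((hGi n).sub hFi).abs.aestronglyMeasurable) (integrable_const _) (fun n => ?_) ?_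
      · filter_upwards [ae_restrict_mem measurableSet_Ioo] with x hx
        rw [Real.norm_eq_abs, abs_abs]
        exact (abs_sub _ _).trans (add_le_add (hGK n x hx) (hFK x hx))
      · filter_upwards [ae_restrict_mem measurableSet_Ioo] with x hx
        simpa using ((hGF x hx).sub_const (F x)).abs
    simpa using this
  set v : ℝ → ℝ := fun x => ∫ t in (-δ)..x, F t with hv
  have hvF : IsWeakDeriv (Ioo (-δ) ℓ) v F := isWeakDeriv_primitive hle hFi
  have hvi : IntegrableOn v (Ioo (-δ) ℓ) :=
    (continuousOn_primitive_Ioo hle hFi).integrableOn_Icc.mono_set Ioo_subset_Icc_self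
  have hui : ∀ n, IntegrableOn (u (σ n)) (Ioo (-δ) ℓ) := fun n =>
    (memSobolev_one_one hδ hℓ (hu (σ n))).1.integrable le_rfl
  have hu0 : Tendsto (fun n => ∫ x in Ioo (-δ) ℓ, |u (σ n) x - v x|) atTop (𝓝 0) := by
    refine (tendsto_integral_primitive_sub hle hGi hFi hL1).congr fun n => ?_
    refine integral_congr_ae ?_
    filter_upwards [ae_eq_deflection hδ hℓ (hu (σ n))] with x hx
    rw [hx]
    rfl
  have hdF : weakDeriv (Ioo (-δ) ℓ) v =ᵐ[volume.restrict (Ioo (-δ) ℓ)] F := hvF.weakDeriv_ae_eq hΩ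
  set μ : SignedMeasure (Ioo (-δ) ℓ) :=
    ((volume.restrict (Ico 0 ℓ)).withDensityᵥ k).map (cantorMapIoo hδ hℓ) with hμ
  have hμd : IsMeasureDeriv (Ioo (-δ) ℓ) (weakDeriv (Ioo (-δ) ℓ) v) μ := by
    refine ⟨hvF.isWeakDeriv_weakDeriv.2.1, fun φ hφ => ?_⟩
    obtain ⟨B, hB⟩ := hφ.2.1.exists_bound_of_continuous hφ.continuous
    obtain ⟨B', hB'⟩ := hφ.deriv.2.1.exists_bound_of_continuous hφ.deriv.continuous
    have h1 : ∫ᵛ x : Ioo (-δ) ℓ, φ x ∂<•μ = ∫ y in Ico 0 ℓ, φ (cantorMap ℓ y) * k y := by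
      rw [hμ, integral_map_withDensityᵥ (ψ := fun x : Ioo (-δ) ℓ => φ x)
        (measurable_cantorMapIoo hδ hℓ) hki
        (hφ.continuous.measurable.comp measurable_subtype_coe) fun x => hB x]
      refine integral_congr_ae ?_
      filter_upwards [ae_cantorMap_mem_Ioo hδ hℓ] with y hy
      rw [coe_cantorMapIoo hδ hℓ hy]
    have h2 : ∫ x in Ioo (-δ) ℓ, weakDeriv (Ioo (-δ) ℓ) v x * deriv φ x =
        ∫ x in Ioo (-δ) ℓ, F x * deriv φ x := by
      refine integral_congr_ae ?_
      filter_upwards [hdF] with x hx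
      rw [hx]
    rw [h1, h2]
    have h3 : Tendsto (fun n => ∫ x in Ioo (-δ) ℓ, slope δ ℓ (u (σ n)) x * deriv φ x) atTop
        (𝓝 (∫ x in Ioo (-δ) ℓ, F x * deriv φ x)) := by
      refine tendsto_integral_of_dominated_convergence (fun _ => K * B')
        (fun n => (hGi n).aestronglyMeasurable.mul hφ.deriv.continuous.aestronglyMeasurable)
        (integrable_const _) (fun n => ?_) ?_
      · filter_upwards [ae_restrict_mem measurableSet_Ioo] with x hx
        rw [norm_mul]
        exact mul_le_mul (hGK n x hx) (hB' x) (norm_nonneg _) ((abs_nonneg _).trans (hFK x hx))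
      · filter_upwards [ae_restrict_mem measurableSet_Ioo] with x hx
        exact (hGF x hx).mul_const _
    -- The identity between slope and curvature holds for each `n`; both sides converge, so it
    -- persists for `F` and `μ`.
    refine tendsto_nhds_unique h3 ?_
    have h4 := (hpass φ B hφ.continuous.measurable hB
      (.of_forall fun y => hφ.continuous.continuousAt)).neg
    refine h4.congr fun n => ?_
    rw [(isWeakDeriv_slope_curvature hδ hℓ (hu (σ n))).2.2 φ hφ]
    simp_rw [mul_comm]
  refine ⟨σ, hσ, v, ⟨memLp_one_iff_integrable.2 hvi, F, hvF, memLp_one_iff_integrable.2 hFi⟩,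
    ⟨memLp_one_iff_integrable.2 (hFi.congr hdF.symm), μ, hμd⟩,
    tendstoSobolev_one_one hΩ (fun n => isWeakDeriv_slope hδ hℓ (hu (σ n))) hvF hui hGi hvi hFi
      hu0 hL1, μ, hμd, fun ψ => ?_, cantor_map_withDensityᵥ_absolutelyContinuous hδ hℓ k⟩
  have hemb : MeasurableEmbedding ((↑) : Ioo (-δ) ℓ → ℝ) := .subtype_coe measurableSet_Ioo
  obtain ⟨B, hB⟩ := ψ.hasCompactSupport.exists_bound_of_continuous ψ.continuous
  have hψm : Measurable ψ := ψ.continuous.measurable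
  -- Extension by zero is continuous at every point of `(-δ, ℓ)`, and that is enough, since
  -- `cantorMap ℓ` takes values there for a.e. `y`.
  set ψ' : ℝ → ℝ := Function.extend ((↑) : Ioo (-δ) ℓ → ℝ) ψ 0 with hψ'
  have hext : ∀ x : Ioo (-δ) ℓ, ψ' x = ψ x := fun x => Subtype.val_injective.extend_apply _ _ x
  have hB' : ∀ x, |ψ' x| ≤ B := fun x => by
    by_cases hx : x ∈ Ioo (-δ) ℓ
    · rw [show ψ' x = ψ ⟨x, hx⟩ from hext ⟨x, hx⟩]
      exact hB _
    · rw [hψ', Function.extend_apply' _ _ _ fun ⟨a, ha⟩ => hx (ha ▸ a.2), Pi.zero_apply, abs_zero]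
      exact (norm_nonneg _).trans (hB ⟨0, neg_lt_zero.2 hδ, hℓ⟩)
  have hcont : ∀ x ∈ Ioo (-δ) ℓ, ContinuousAt ψ' x := fun x hx => by
    have hoe : IsOpenEmbedding ((↑) : Ioo (-δ) ℓ → ℝ) := hΩ.isOpenEmbedding_subtypeVal
    refine (hoe.continuousAt_iff (x := ⟨x, hx⟩)).1 ?_
    rw [show ψ' ∘ ((↑) : Ioo (-δ) ℓ → ℝ) = ψ from funext hext]
    exact ψ.continuous.continuousAt
  have h1 := hpass ψ' B (hemb.measurable_extend hψm measurable_const) hB' (by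
    filter_upwards [ae_cantorMap_mem_Ioo hδ hℓ] with y hy using hcont _ hy)
  have h2 : ∫ᵛ x, ψ x ∂<•μ = ∫ y in Ico 0 ℓ, ψ' (cantorMap ℓ y) * k y := by
    rw [hμ, integral_map_withDensityᵥ (measurable_cantorMapIoo hδ hℓ) hki hψm hB]
    refine integral_congr_ae ?_
    filter_upwards [ae_cantorMap_mem_Ioo hδ hℓ] with y hy
    rw [← hext, coe_cantorMapIoo hδ hℓ hy]
  rw [h2]
  refine h1.congr fun n => ?_
  exact (integral_densityMeasure measurableSet_Ioo (integrableOn_curvature (hu (σ n))) hψm hB).symm
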